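/- **Theorem (Generalized Leibniz rule).** Let $E$ be an Adams type ring spectrum and let $\mathrm{Syn}_E$ be the $\infty$-category of $E$-based synthetic spectra, that is, of spherical sheaves of spectra on the site of finite spectra $P$ with $E_*P$ finitely generated projective over $E_*$ (covers are the $E_*$-surjections). Bigraded suspension is $(\Sigma^{a,b}X)(P)=\Sigma^{-b}X(\Sigma^{-a-b}P)$, so that $\pi_{a,b}X=\pi_{-b}X(S^{a+b})$, the map $\tau\colon\Sigma^{0,-1}X\to X$ is adjoint to the canonical map $X(\Sigma P)\to\Omega X(P)$, and $X/\tau^k$ is the cofibre of $\tau^k\colon \Sigma^{0,-k}X\to X$. Let $r_k\colon X\to X/\tau^k$ and $r_{n,k}\colon X/\tau^n\to X/\tau^k$ be the reductions, $\tau^{s}\colon X/\tau^{k}\to X/\tau^{k+s}$ the maps induced by $\tau^s$, and $\delta=\delta_1\colon X/\tau\to X$ the boundary map (suspensions omitted). A lift of $x\in\pi_{*,*}X/\tau$ is an element that reduces to $x$ mod $\tau$. For $x\in\pi_{*,*}X/\tau$ and $r\ge 2$: $x$ *survives to the $E_r$ page* if $\delta x=\tau^{r-2}y$ for some $y\in\pi_{*,*}X$;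 the representatives on the $E_2$ page of $d_r(x)$ are the elements $-r_1(y)$ for all such $y$. We write $d_r(x)=z$ if $z$ is such a representative. Let $\alpha\colon X\to Y$ be a map of synthetic spectra. * For $2\le r<\infty$ and $0\le s<r-1$, $y\in\pi_{*,*}Y/\tau$ is a *maximal hidden $\alpha$-extension of $x\in\pi_{*,*}X/\tau$ by $s$ on the $E_r$ page* if there are lifts $\{x\}\in\pi_{*,*}X/\tau^{r-1}$ of $x$ and $\{y\}\in\pi_{*,*}Y/\tau^{r-1-s}$ of $y$ with $\alpha\{x\}=\tau^s\{y\}$ and such that either $s=r-2$, or $\alpha\{x\}$ is not $\tau^{s+1}$ times an element of $\pi_{*,*}Y/\tau^{r-2-s}$. * For $0\le s<\infty$, $y$ is a *maximal hidden $\alpha$-extension of $x$ by $s$ on the $E_\infty$ page* if there are lifts $\{x\}\in\pi_{*,*}X$ and $\{y\}\in\pi_{*,*}Y$ with $\alpha\{x\}=\tau^s\{y\}$ and $\alpha\{x\}$ not divisible by $\tau^{s+1}$. There is a *maximal hidden $\alpha$-extension of $x$ by $\infty$ to $0$ on the $E_\infty$ page* if $x$ has a lift $\{x\}\in\pi_{*,*}X$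 such that $\alpha\{x\}$ is divisible by every power of $\tau$. Let $r\ge 2$, let $x\in\pi_{*,*}X/\tau$ survive to the $E_r$ page, and fix a representative $d\in\pi_{*,*}X/\tau$ of $d_r(x)$ on the $E_2$ page. Then there are an $s$ with $0\le s<r-1$ and a maximal hidden $\alpha$-extension $y$ of $x$ by $s$ on the $E_r$ page such that one of the following holds: 1. there are an $s'$ with $0\le s'<\infty$ and a maximal hidden $\alpha$-extension $z$ of $d$ by $s'$ on the $E_\infty$ page such that $y$ survives to the $E_{r+s'-s}$ page and $d_{r+s'-s}(y)=z$; 2. there is a maximal hidden $\alpha$-extension of $d$ by $\infty$ to $0$ on the $E_\infty$ page, and, for every $q\ge 2$, $y$ survives to the $E_q$ page and $d_q(y)=0$. -/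

import Mathlib

open CategoryTheory Opposite Topology
open scoped unitInterval

universe u v

/-! ### Pointed topological spaces -/

/-- A pointed topological space. -/
structure PtdTop where
  carrier : Type u
  [top : TopologicalSpace carrier]
  pt : carrier

namespace PtdTop

instance : CoeSort PtdTop.{u} (Type u) := ⟨PtdTop.carrier⟩

attribute [instance] PtdTop.top

/-- A continuous map that preserves base points. -/
@[ext]
structure Hom (A B : PtdTop.{u}) where
  toMap : C(A, B)
  map_pt : toMap A.pt = B.pt

instance : Category PtdTop.{u} where
  Hom := Hom
  id A := ⟨ContinuousMap.id A, rfl⟩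
  comp f g := ⟨g.toMap.comp f.toMap, by simp [f.map_pt, g.map_pt]⟩

instance (A B : PtdTop.{u}) : CoeFun (A ⟶ B) (fun _ => A → B) := ⟨fun f => f.toMap⟩

@[ext]
theorem hom_ext {A B : PtdTop.{u}} {f g : A ⟶ B} (h : ∀ x, f x = g x) : f = g :=
  Hom.ext (ContinuousMap.ext h)

@[simp] theorem id_apply (A : PtdTop.{u}) (x : A) : (𝟙 A : A ⟶ A) x = x := rfl

@[simp] theorem comp_apply {A B C : PtdTop.{u}} (f : A ⟶ B) (g : B ⟶ C) (x : A) :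
    (f ≫ g) x = g (f x) := rfl

/-- Build a pointed map from a continuous function. -/
def mkHom {A B : PtdTop.{u}} (f : A → B) (hf : Continuous f) (h : f A.pt = B.pt) : A ⟶ B :=
  Hom.mk ⟨f, hf⟩ h

@[simp] theorem mkHom_apply {A B : PtdTop.{u}} (f : A → B) (hf : Continuous f)
    (h : f A.pt = B.pt) (x : A) : mkHom f hf h x = f x := rfl

theorem continuous_hom {A B : PtdTop.{u}} (f : A ⟶ B) : Continuous f := f.toMap.continuous

/-- The constant map at the base point. -/
def zero (A B : PtdTop.{u}) : A ⟶ B := mkHom (fun _ => B.pt) continuous_const rfl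

/-- The one-point space. -/
def point : PtdTop.{0} := ⟨PUnit, PUnit.unit⟩

/-- The sphere `S⁰`: two points. -/
def sphereZero : PtdTop.{0} := ⟨Bool, false⟩

/-- Pointed homotopy of pointed maps. -/
def Homotopic {A B : PtdTop.{u}} (f g : A ⟶ B) : Prop :=
  ∃ h : C(I × A, B), (∀ a, h (0, a) = f a) ∧ (∀ a, h (1, a) = g a) ∧ ∀ t, h (t, A.pt) = B.pt

/-- A family of pointed maps `A → B`, parametrised continuously by the cube `I^k`.
(These are the `k`-cubes of the mapping space of pointed maps `A → B`.) -/
structure Family (k : ℕ) (A B : PtdTop.{u}) where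
  toMap : C((Fin k → I) × A, B)
  map_pt : ∀ s, toMap (s, A.pt) = B.pt

/-- The member of a family at the parameter `s`. -/
def Family.slice {k : ℕ} {A B : PtdTop.{u}} (f : Family k A B) (s : Fin k → I) : A ⟶ B :=
  mkHom (fun a => f.toMap (s, a)) (by fun_prop) (f.map_pt s)

/-! ### Wedges, mapping cones, suspensions -/

/-- The identification of base points that defines the wedge. -/
inductive WedgeRel (A B : PtdTop.{u}) : A ⊕ B → A ⊕ B → Prop
  | glue : WedgeRel A B (Sum.inl A.pt) (Sum.inr B.pt)

/-- The wedge `A ∨ B`. -/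
def wedge (A B : PtdTop.{u}) : PtdTop.{u} :=
  ⟨Quot (WedgeRel A B), Quot.mk _ (Sum.inr B.pt)⟩

/-- The identifications that define the reduced mapping cone of `f : A → B`: the end `1` of the
cylinder on `A` is glued to `B` along `f`, the end `0` and the line over the base point of `A` are
collapsed to the base point. -/
inductive ConeRel {A B : PtdTop.{u}} (f : A ⟶ B) : (I × A) ⊕ B → (I × A) ⊕ B → Prop
  | glue (a : A) : ConeRel f (Sum.inl (1, a)) (Sum.inr (f a))
  | apex (a : A) : ConeRel f (Sum.inl (0, a)) (Sum.inr B.pt)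
  | base (t : I) : ConeRel f (Sum.inl (t, A.pt)) (Sum.inr B.pt)

/-- The reduced mapping cone of `f : A → B`. -/
def cone {A B : PtdTop.{u}} (f : A ⟶ B) : PtdTop.{u} :=
  ⟨Quot (ConeRel f), Quot.mk _ (Sum.inr B.pt)⟩

/-- The inclusion of `B` into the mapping cone of `f : A → B`. -/
def coneIncl {A B : PtdTop.{u}} (f : A ⟶ B) : B ⟶ cone f :=
  mkHom (fun b => Quot.mk _ (Sum.inr b)) (continuous_quot_mk.comp continuous_inr) rfl

/-- The tautological null-homotopy `t ↦ (a ↦ [t, a])` of `A → B → cone f`, from the constant map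
at `t = 0` to `coneIncl f ∘ f` at `t = 1`. -/
def coneFamily {A B : PtdTop.{u}} (f : A ⟶ B) : Family 1 A (cone f) where
  toMap := ⟨fun p => Quot.mk _ (Sum.inl (p.1 0, p.2)),
    continuous_quot_mk.comp (continuous_inl.comp (by fun_prop))⟩
  map_pt s := Quot.sound (ConeRel.base (s 0))

theorem coneFamily_zero {A B : PtdTop.{u}} (f : A ⟶ B) :
    (coneFamily f).slice (fun _ => 0) = zero A (cone f) :=
  hom_ext fun a => Quot.sound (ConeRel.apex a)

theorem coneFamily_one {A B : PtdTop.{u}} (f : A ⟶ B) :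
    (coneFamily f).slice (fun _ => 1) = f ≫ coneIncl f :=
  hom_ext fun a => Quot.sound (ConeRel.glue a)

/-- The reduced suspension `Σ A`, as the mapping cone of `A → *`. -/
def susp (A : PtdTop.{0}) : PtdTop.{0} := cone (zero A point)

/-- The map `Σ A → Σ B` induced by `A → B`. -/
def suspMap {A B : PtdTop.{0}} (f : A ⟶ B) : susp A ⟶ susp B :=
  mkHom (Quot.map (Sum.map (fun p => (p.1, f p.2)) id) (by
      rintro _ _ (a | a | t)
      · exact ConeRel.glue (f a)
      · exact ConeRel.apex (f a)
      · have h := ConeRel.base (f := zero B point) t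
        rw [← f.map_pt] at h
        exact h))
    (by
      refine continuous_quot_lift _ (continuous_quot_mk.comp ?_)
      exact Continuous.sumMap
        (continuous_fst.prodMk (f.toMap.continuous.comp continuous_snd)) continuous_id)
    rfl

theorem coneFamily_one_susp (A : PtdTop.{0}) :
    (coneFamily (zero A point)).slice (fun _ => 1) = zero A (susp A) := by
  rw [coneFamily_one]; rfl

/-- Suspension as a functor. -/
def suspFunctor : PtdTop.{0} ⥤ PtdTop.{0} where
  obj := susp
  map := suspMap
  map_id A := hom_ext (by rintro ⟨⟨t, a⟩ | b⟩ <;> rfl)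
  map_comp f g := hom_ext (by rintro ⟨⟨t, a⟩ | b⟩ <;> rfl)

/-- The class of finite pointed homotopy types: the smallest class of pointed spaces that contains
the point and `S⁰` and is closed under wedges, mapping cones and pointed homotopy equivalence. -/
inductive IsFinite : PtdTop.{0} → Prop
  | point : IsFinite point
  | sphereZero : IsFinite sphereZero
  | wedge {A B : PtdTop.{0}} : IsFinite A → IsFinite B → IsFinite (wedge A B)
  | cone {A B : PtdTop.{0}} (f : A ⟶ B) : IsFinite A → IsFinite B → IsFinite (cone f)
  | homotopyEquiv {A B : PtdTop.{0}} (f : A ⟶ B) (g : B ⟶ A) :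
      Homotopic (f ≫ g) (𝟙 A) → Homotopic (g ≫ f) (𝟙 B) → IsFinite A → IsFinite B

/-! ### Loops, homotopy fibres, homotopy groups -/

/-- The loop space, with the delta-generated topology (the mapping space in the convenient
category of delta-generated spaces). -/
def loop (Z : PtdTop.{u}) : PtdTop.{u} :=
  ⟨WithGeneratedByTopology (fun n : ℕ => Fin n → ℝ) (LoopSpace Z Z.pt),
    WithGeneratedByTopology.equiv.symm (Path.refl Z.pt)⟩

/-- The underlying path of a point of the loop space. -/
def loopPath {Z : PtdTop.{u}} (x : loop Z) : LoopSpace Z Z.pt :=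
  WithGeneratedByTopology.equiv (X := fun n : ℕ => Fin n → ℝ) x

theorem continuous_loopPath (Z : PtdTop.{u}) : Continuous (loopPath (Z := Z)) :=
  WithGeneratedByTopology.continuous_equiv (X := fun n : ℕ => Fin n → ℝ)

/-- The point of the loop space given by a loop. -/
def loopMk {Z : PtdTop.{u}} (γ : LoopSpace Z Z.pt) : loop Z :=
  (WithGeneratedByTopology.equiv (X := fun n : ℕ => Fin n → ℝ)).symm γ

theorem continuous_loopMk {Z : PtdTop.{u}} {T : Type u} [TopologicalSpace T]
    [DeltaGeneratedSpace T] {g : T → LoopSpace Z Z.pt} (hg : Continuous g) :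
    Continuous fun x => loopMk (g x) :=
  (IsGeneratedBy.equiv_symm_comp_continuous_iff (X := fun n : ℕ => Fin n → ℝ) g).2 hg

theorem deltaGenerated_loop (Z : PtdTop.{u}) : DeltaGeneratedSpace (loop Z) :=
  IsGeneratedBy.instWithGeneratedByTopology (X := fun n : ℕ => Fin n → ℝ)
    (Y := LoopSpace Z Z.pt)

/-- The homotopy fibre of `p : Z → W`: points `z` of `Z` with a path from the base point
to `p z`. -/
def hofib {Z W : PtdTop.{u}} (p : Z ⟶ W) : PtdTop.{u} :=
  ⟨{x : Z × C(I, W) // x.2 0 = W.pt ∧ x.2 1 = p x.1},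
    ⟨(Z.pt, ContinuousMap.const I W.pt), rfl, p.map_pt.symm⟩⟩

/-- The projection `hofib p → Z`. -/
def hofibFst {Z W : PtdTop.{u}} (p : Z ⟶ W) : hofib p ⟶ Z :=
  mkHom (fun x => x.1.1) (by fun_prop) rfl

/-- The inclusion `Ω W → hofib p`. -/
def loopToHofib {Z W : PtdTop.{u}} (p : Z ⟶ W) : loop W ⟶ hofib p :=
  mkHom (fun ω => ⟨(Z.pt, (loopPath ω).toContinuousMap), (loopPath ω).source,
      (loopPath ω).target.trans p.map_pt.symm⟩)
    (by
      refine Continuous.subtype_mk (continuous_const.prodMk ?_) _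
      exact continuous_induced_dom.comp (continuous_loopPath W))
    rfl

/-- The map of homotopy fibres induced by a commutative square. -/
def hofibMap {Z W Z' W' : PtdTop.{u}} {p : Z ⟶ W} {p' : Z' ⟶ W'} (f : Z ⟶ Z') (g : W ⟶ W')
    (h : p ≫ g = f ≫ p') : hofib p ⟶ hofib p' :=
  mkHom (fun x => ⟨(f x.1.1, g.toMap.comp x.1.2),
      by simp [x.2.1, g.map_pt],
      by
        have := congrArg (fun k : Z ⟶ W' => k x.1.1) h
        simpa [x.2.2] using this⟩)
    (by
      refine Continuous.subtype_mk ?_ _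
      exact ((continuous_hom f).comp (continuous_fst.comp continuous_subtype_val)).prodMk
        ((ContinuousMap.continuous_postcomp g.toMap).comp
          (continuous_snd.comp continuous_subtype_val)))
    (by
      apply Subtype.ext
      exact Prod.ext f.map_pt (ContinuousMap.ext fun _ => g.map_pt))

/-- The map on homotopy sets `π_n(Z, z) → π_n(W, f z)` induced by a continuous map. -/
def piMap {Z W : Type u} [TopologicalSpace Z] [TopologicalSpace W] (f : C(Z, W)) (n : ℕ) {z : Z}
    {w : W} (h : f z = w) : HomotopyGroup.Pi n Z z → HomotopyGroup.Pi n W w :=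
  Quotient.map (fun p => ⟨f.comp p.1, fun y hy => by
      rw [ContinuousMap.comp_apply, p.2 y hy, h]⟩)
    (fun _ _ hpq => hpq.map fun H => H.compContinuousMap f)

/-- Weak homotopy equivalence: bijective on `π_n` for all `n ≥ 0` and all base points. -/
def IsWeakEquiv {Z W : PtdTop.{u}} (f : Z ⟶ W) : Prop :=
  ∀ (n : ℕ) (z : Z), Function.Bijective (piMap f.toMap n (rfl : f.toMap z = f.toMap z))

/-- The second homotopy group of a pointed space, written additively. -/
abbrev Pi2 (Z : PtdTop.{u}) : Type u := Additive (HomotopyGroup.Pi 2 Z Z.pt)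

/-- The map induced on second homotopy groups. -/
def pi2Map {Z W : PtdTop.{u}} (f : Z ⟶ W) (x : Pi2 Z) : Pi2 W :=
  Additive.ofMul (piMap f.toMap 2 f.map_pt x.toMul)

end PtdTop

open PtdTop

/-! ### Homology theories and the site of `E`-projective finite spectra -/

/-- The category of finite pointed homotopy types (modelled by actual spaces). -/
abbrev FinCpx : Type 1 := ObjectProperty.FullSubcategory (C := PtdTop.{0}) PtdTop.IsFinite

namespace FinCpx

/-- `S⁰`. -/
def sphereZero : FinCpx := ⟨PtdTop.sphereZero, .sphereZero⟩

/-- The mapping cone of a map of finite pointed homotopy types. -/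
def cone {A B : FinCpx} (f : A ⟶ B) : FinCpx :=
  ⟨PtdTop.cone f.hom, .cone f.hom A.property B.property⟩

/-- The inclusion of `B` into the mapping cone of `A → B`. -/
def coneIncl {A B : FinCpx} (f : A ⟶ B) : B ⟶ cone f :=
  ObjectProperty.homMk (PtdTop.coneIncl f.hom)

/-- Suspension of finite pointed homotopy types. -/
def suspFunctor : FinCpx ⥤ FinCpx where
  obj A := ⟨PtdTop.susp A.obj, .cone _ A.property .point⟩
  map f := ObjectProperty.homMk (PtdTop.suspMap f.hom)
  map_id A := ObjectProperty.hom_ext _ (PtdTop.suspFunctor.map_id A.obj)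
  map_comp f g := ObjectProperty.hom_ext _ (PtdTop.suspFunctor.map_comp f.hom g.hom)

end FinCpx

/-- A reduced (generalised) homology theory `E` on finite pointed homotopy types with values in
modules over its coefficient ring: `R` is the ring `E_* = ⨁ₙ Eₙ` and `H A` is the left `R`-module
`E_* A = ⨁ₙ Eₙ A`. The axioms are homotopy invariance, exactness and the suspension isomorphism.
Every ring spectrum `E`, in particular every one of Adams type, gives such a theory,
`H A = π_* (E ∧ A)`; the site of finite `E`-projective spectra depends on this theory only.
(Since `R` and `H A` are graded, it does not matter whether "finitely generated" and "projective"
are read in the graded or in the ungraded sense.) -/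
structure HomologyTheory where
  R : Type v
  [ring : Ring R]
  H : FinCpx ⥤ ModuleCat.{v} R
  homotopy {A B : FinCpx} (f g : A ⟶ B) : PtdTop.Homotopic f.hom g.hom → H.map f = H.map g
  exact {A B : FinCpx} (f : A ⟶ B) :
    Function.Exact (H.map f).hom (H.map (FinCpx.coneIncl f)).hom
  suspIso : FinCpx.suspFunctor ⋙ H ≅ H
  coeffIso : H.obj FinCpx.sphereZero ≅ ModuleCat.of R R

namespace HomologyTheory

attribute [instance] HomologyTheory.ring

variable (E : HomologyTheory.{v})

/-- `E_* A` is a finitely generated projective `E_*`-module. -/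
def IsProjective : ObjectProperty FinCpx :=
  fun A => Module.Finite E.R (E.H.obj A) ∧ Module.Projective E.R (E.H.obj A)

/-- The category of finite pointed homotopy types `A` with `E_* A` finitely generated and
projective. The finite `E`-projective spectra are the formal desuspensions `Σ^{-n} A` of the
objects `A` of this category. -/
abbrev FP : Type 1 := E.IsProjective.FullSubcategory

theorem isProjective_of_iso {A B : FinCpx} (e : E.H.obj A ≅ E.H.obj B) (h : E.IsProjective A) :
    E.IsProjective B := by
  obtain ⟨h1, h2⟩ := h
  exact ⟨Module.Finite.equiv e.toLinearEquiv, Module.Projective.of_equiv e.toLinearEquiv⟩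

/-- `S⁰` as an `E`-projective finite complex. -/
def sphereZero : E.FP :=
  ⟨FinCpx.sphereZero,
    Module.Finite.equiv E.coeffIso.symm.toLinearEquiv,
    Module.Projective.of_equiv E.coeffIso.symm.toLinearEquiv⟩

/-- The pointed space that underlies an object of `E.FP`. -/
abbrev space (A : E.FP) : PtdTop.{0} := A.obj.obj

/-- A pointed continuous map as a morphism of `E.FP`. -/
def ofMap {E : HomologyTheory.{v}} {A B : E.FP} (f : E.space A ⟶ E.space B) : A ⟶ B :=
  ObjectProperty.homMk (ObjectProperty.homMk f)

/-- Suspension on `E.FP`. -/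
def suspFP : E.FP ⥤ E.FP where
  obj A := ⟨FinCpx.suspFunctor.obj A.obj,
    E.isProjective_of_iso (E.suspIso.app A.obj).symm A.property⟩
  map f := ObjectProperty.homMk (FinCpx.suspFunctor.map f.hom)
  map_id A := ObjectProperty.hom_ext _ (FinCpx.suspFunctor.map_id A.obj)
  map_comp f g := ObjectProperty.hom_ext _ (FinCpx.suspFunctor.map_comp f.hom g.hom)

/-- The mapping cone of a map in `E.FP`, when it lies in `E.FP` again. -/
def coneFP {A B : E.FP} (f : A ⟶ B) (h : E.IsProjective (FinCpx.cone f.hom)) : E.FP :=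
  ⟨FinCpx.cone f.hom, h⟩

/-- The inclusion of `B` into the cone of `A → B`. -/
def coneIncl {A B : E.FP} (f : A ⟶ B) (h : E.IsProjective (FinCpx.cone f.hom)) :
    B ⟶ E.coneFP f h :=
  ObjectProperty.homMk (FinCpx.coneIncl f.hom)

/-- The tautological null-homotopy of `A → B → cone`. -/
def coneFamily {A B : E.FP} (f : A ⟶ B) (h : E.IsProjective (FinCpx.cone f.hom)) :
    Family 1 (E.space A) (E.space (E.coneFP f h)) :=
  PtdTop.coneFamily f.hom.hom

theorem coneFamily_zero {A B : E.FP} (f : A ⟶ B) (h : E.IsProjective (FinCpx.cone f.hom)) :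
    (E.coneFamily f h).slice (fun _ => 0) = zero _ _ :=
  PtdTop.coneFamily_zero f.hom.hom

theorem coneFamily_one {A B : E.FP} (f : A ⟶ B) (h : E.IsProjective (FinCpx.cone f.hom)) :
    ofMap ((E.coneFamily f h).slice (fun _ => 1)) = f ≫ E.coneIncl f h :=
  ObjectProperty.hom_ext _ (ObjectProperty.hom_ext _ (PtdTop.coneFamily_one f.hom.hom))

/-- The tautological loop `t ↦ (a ↦ [t, a])` of maps `A → Σ A`. -/
def suspFamily (A : E.FP) : Family 1 (E.space A) (E.space (E.suspFP.obj A)) :=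
  PtdTop.coneFamily (zero (E.space A) point)

theorem suspFamily_zero (A : E.FP) : (E.suspFamily A).slice (fun _ => 0) = zero _ _ :=
  PtdTop.coneFamily_zero _

theorem suspFamily_one (A : E.FP) : (E.suspFamily A).slice (fun _ => 1) = zero _ _ :=
  PtdTop.coneFamily_one_susp _

end HomologyTheory

open HomologyTheory (ofMap)

/-! ### Synthetic spectra -/

/-- A contravariant functor to pointed spaces that is pointed and continuous: it sends constant
maps to constant maps, and depends continuously on the parameter in every cube of maps. In other
words: a presheaf enriched in pointed spaces. -/
structure IsEnriched {E : HomologyTheory.{v}} (F : E.FPᵒᵖ ⥤ PtdTop.{u}) : Prop where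
  map_zero (A B : E.FP) :
    F.map (ofMap (zero (E.space A) (E.space B))).op = zero (F.obj (op B)) (F.obj (op A))
  continuous_family {A B : E.FP} {k : ℕ} (f : Family k (E.space A) (E.space B)) :
    Continuous fun p : (Fin k → I) × F.obj (op B) => F.map (ofMap (f.slice p.1)).op p.2

namespace IsEnriched

/-- For a one-parameter family of maps `fₜ : A → B` and a point `y` of `F B`,
the path `t ↦ F(fₜ) y` in `F A`. -/
def path {E : HomologyTheory.{v}} {F : E.FPᵒᵖ ⥤ PtdTop.{u}} (hF : IsEnriched F) {A B : E.FP}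
    (f : Family 1 (E.space A) (E.space B)) : C(F.obj (op B), C(I, F.obj (op A))) :=
  ContinuousMap.curry ⟨fun p => F.map (ofMap (f.slice fun _ => p.2)).op p.1,
    (hF.continuous_family f).comp
      ((continuous_pi fun _ => continuous_snd).prodMk continuous_fst)⟩

theorem path_apply {E : HomologyTheory.{v}} {F : E.FPᵒᵖ ⥤ PtdTop.{u}} (hF : IsEnriched F)
    {A B : E.FP} (f : Family 1 (E.space A) (E.space B)) (y : F.obj (op B)) (t : I) :
    hF.path f y t = F.map (ofMap (f.slice fun _ => t)).op y := rfl

theorem path_apply_of_eq_zero {E : HomologyTheory.{v}} {F : E.FPᵒᵖ ⥤ PtdTop.{u}}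
    (hF : IsEnriched F) {A B : E.FP} (f : Family 1 (E.space A) (E.space B)) (y : F.obj (op B))
    {t : I} (h : f.slice (fun _ => t) = zero _ _) : hF.path f y t = (F.obj (op A)).pt := by
  rw [path_apply, h, hF.map_zero]; rfl

theorem path_pt {E : HomologyTheory.{v}} {F : E.FPᵒᵖ ⥤ PtdTop.{u}}
    (hF : IsEnriched F) {A B : E.FP} (f : Family 1 (E.space A) (E.space B)) :
    hF.path f (F.obj (op B)).pt = ContinuousMap.const I (F.obj (op A)).pt :=
  ContinuousMap.ext fun t => (F.map (ofMap (f.slice fun _ => t)).op).map_pt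

/-- For a map `f : A → B` with cone `C`, the canonical map from `F C` to the homotopy fibre
of `F B → F A`. -/
def toHofib {E : HomologyTheory.{v}} {F : E.FPᵒᵖ ⥤ PtdTop.{u}} (hF : IsEnriched F)
    {A B : E.FP} (f : A ⟶ B) (h : E.IsProjective (FinCpx.cone f.hom)) :
    F.obj (op (E.coneFP f h)) ⟶ hofib (F.map f.op) :=
  mkHom (fun y => ⟨(F.map (E.coneIncl f h).op y, hF.path (E.coneFamily f h) y),
      hF.path_apply_of_eq_zero _ y (E.coneFamily_zero f h),
      by
        change hF.path (E.coneFamily f h) y 1 = F.map f.op (F.map (E.coneIncl f h).op y)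
        rw [path_apply, E.coneFamily_one, ← PtdTop.comp_apply, ← F.map_comp, ← op_comp]⟩)
    (Continuous.subtype_mk ((continuous_hom _).prodMk (ContinuousMap.continuous _)) _)
    (Subtype.ext (Prod.ext (F.map _).map_pt (hF.path_pt _)))

/-- The loop `t ↦ F(fₜ) y`, where `fₜ : A → Σ A` is the tautological loop of maps. -/
def loopAt {E : HomologyTheory.{v}} {F : E.FPᵒᵖ ⥤ PtdTop.{u}} (hF : IsEnriched F) (A : E.FP)
    (y : F.obj (op (E.suspFP.obj A))) : LoopSpace (F.obj (op A)) (F.obj (op A)).pt :=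
  ⟨hF.path (E.suspFamily A) y, hF.path_apply_of_eq_zero _ y (E.suspFamily_zero A),
    hF.path_apply_of_eq_zero _ y (E.suspFamily_one A)⟩

theorem continuous_loopAt {E : HomologyTheory.{v}} {F : E.FPᵒᵖ ⥤ PtdTop.{u}}
    (hF : IsEnriched F) (A : E.FP) : Continuous (hF.loopAt A) :=
  continuous_induced_rng.2 (hF.path (E.suspFamily A)).continuous

/-- The canonical map `F (Σ A) → Ω (F A)`, `y ↦ (t ↦ F(fₜ) y)`. -/
def toLoop {E : HomologyTheory.{v}} {F : E.FPᵒᵖ ⥤ PtdTop.{u}} (hF : IsEnriched F) (A : E.FP)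
    (hd : DeltaGeneratedSpace (F.obj (op (E.suspFP.obj A)))) :
    F.obj (op (E.suspFP.obj A)) ⟶ loop (F.obj (op A)) :=
  mkHom (fun y => loopMk (hF.loopAt A y))
    (continuous_loopMk (hF.continuous_loopAt A))
    (congrArg loopMk (Path.ext (congrArg (fun γ : C(I, F.obj (op A)) => (γ : I → F.obj (op A)))
      (hF.path_pt _))))

end IsEnriched

/-- An `E`-based synthetic spectrum: a spherical sheaf of spectra on the site of finite
`E`-projective spectra.

* A finite spectrum is a formal desuspension `Σ^{-n} A` of a finite pointed homotopy type, so a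
  presheaf `X` of spectra on finite `E`-projective spectra is a sequence, indexed by `n : ℤ`, of
  presheaves `A ↦ X(Σ^{-n} A)` on `E.FP`, with equivalences `desusp` from the `n`-th presheaf at
  `A` to the `n+1`-st presheaf at `Σ A`.
* A spectrum is a sequence, indexed by `m : ℤ`, of pointed spaces with homeomorphisms `deloop` from
  the `m`-th space to the loop space of the `m+1`-st one.
* The presheaf is a spherical sheaf iff it sends every cofibre sequence `A → B → C` in which
  `E_* B → E_* C` is surjective (that is, `B → C` is a cover) to a fibre sequence.

So `obj n m A` is the `m`-th space of the spectrum `X(Σ^{-n} A)`. The presheaves are functors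
enriched in pointed spaces, which model the presheaves on the `∞`-category of finite spectra. -/
structure SyntheticSpectrum (E : HomologyTheory.{v}) where
  obj (n m : ℤ) : E.FPᵒᵖ ⥤ PtdTop.{u}
  enriched (n m : ℤ) : IsEnriched (obj n m)
  deloop (n m m' : ℤ) (h : m' = m + 1) (A : E.FPᵒᵖ) :
    (obj n m).obj A ≃ₜ loop ((obj n m').obj A)
  deloop_map (n m m' : ℤ) (h : m' = m + 1) {A B : E.FPᵒᵖ} (f : A ⟶ B) (x : (obj n m).obj A)
    (t : I) : loopPath (deloop n m m' h B ((obj n m).map f x)) t =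
      (obj n m').map f (loopPath (deloop n m m' h A x) t)
  desusp (n n' m : ℤ) (h : n' = n + 1) : obj n m ⟶ E.suspFP.op ⋙ obj n' m
  desusp_isWeakEquiv (n n' m : ℤ) (h : n' = n + 1) (A : E.FPᵒᵖ) :
    IsWeakEquiv ((desusp n n' m h).app A)
  desusp_deloop (n n' m m' : ℤ) (h : n' = n + 1) (h' : m' = m + 1) (A : E.FPᵒᵖ)
    (x : (obj n m).obj A) (t : I) :
    loopPath (deloop n' m m' h' _ ((desusp n n' m h).app A x)) t =
      (desusp n n' m' h).app A (loopPath (deloop n m m' h' A x) t)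
  sheaf (n m : ℤ) {A B : E.FP} (f : A ⟶ B) (h : E.IsProjective (FinCpx.cone f.hom))
    (hf : Function.Surjective (E.H.map (FinCpx.coneIncl f.hom)).hom) :
    IsWeakEquiv ((enriched n m).toHofib f h)

namespace SyntheticSpectrum

variable {E : HomologyTheory.{v}}

/-- A strict map of synthetic spectra. -/
structure Hom (X Y : SyntheticSpectrum.{u} E) where
  app (n m : ℤ) : X.obj n m ⟶ Y.obj n m
  app_deloop (n m m' : ℤ) (h : m' = m + 1) (A : E.FPᵒᵖ) (x : (X.obj n m).obj A) (t : I) :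
    loopPath (Y.deloop n m m' h A ((app n m).app A x)) t =
      (app n m').app A (loopPath (X.deloop n m m' h A x) t)
  app_desusp (n n' m : ℤ) (h : n' = n + 1) (A : E.FPᵒᵖ) (x : (X.obj n m).obj A) :
    (Y.desusp n n' m h).app A ((app n m).app A x) =
      (app n' m).app _ ((X.desusp n n' m h).app A x)

/-- An equivalence of synthetic spectra: a strict map that is a weak equivalence on all values. -/
def Hom.IsEquiv {X Y : SyntheticSpectrum.{u} E} (f : Hom X Y) : Prop :=
  ∀ (n m : ℤ) (A : E.FPᵒᵖ), IsWeakEquiv ((f.app n m).app A)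

/-- A map of synthetic spectra, that is, a morphism `X ⟵ Z ⟶ Y` of the localisation of strict maps
at the equivalences. -/
structure Map (X Y : SyntheticSpectrum.{u} E) where
  apex : SyntheticSpectrum.{u} E
  left : Hom apex X
  left_isEquiv : left.IsEquiv
  right : Hom apex Y

variable (X : SyntheticSpectrum.{u} E)

theorem deltaGenerated (n m : ℤ) (A : E.FPᵒᵖ) : DeltaGeneratedSpace ((X.obj n m).obj A) :=
  haveI := deltaGenerated_loop ((X.obj n (m + 1)).obj A)
  (X.deloop n m (m + 1) rfl A).symm.isQuotientMap.isGeneratedBy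

theorem deloop_pt (n m m' : ℤ) (h : m' = m + 1) (A : E.FPᵒᵖ) :
    X.deloop n m m' h A ((X.obj n m).obj A).pt = (loop ((X.obj n m').obj A)).pt := by
  have key : ∀ t, loopPath (X.deloop n m m' h A ((X.obj n m).obj A).pt) t
      = ((X.obj n m').obj A).pt := fun t => by
    have h1 := X.deloop_map n m m' h (ofMap (zero (E.space A.unop) (E.space A.unop))).op
      ((X.obj n m).obj A).pt t
    have h2 := (X.enriched n m').map_zero A.unop A.unop
    rw [((X.obj n m).map _).map_pt] at h1
    rw [h1]
    exact congrArg (fun k : (X.obj n m').obj A ⟶ (X.obj n m').obj A =>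
      k (loopPath (X.deloop n m m' h A ((X.obj n m).obj A).pt) t)) h2
  exact congrArg loopMk (Path.ext (funext key))

/-! ### Values on spheres, the map `τ`, and homotopy groups -/

/-- The `m`-th space of the spectrum `X(S^j)`, where `S^j = Σ^j S⁰` is the `j`-sphere. -/
def sphereValue (j m : ℤ) : PtdTop.{u} := (X.obj (-j) m).obj (op E.sphereZero)

/-- The map `τ`, from the `m+1`-st space of `X(S^{j+1})` to the `m`-th space of `X(S^j)`: the
canonical map `X(Σ S^j) → Ω X(S^j)`, on `m+1`-st spaces, followed by the identification of the loop
space of the `m+1`-st space with the `m`-th space. As `(Σ^{0,-1} X)(P) = Σ X(Σ P)`, this is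
the value of `τ : Σ^{0,-1} X → X` at `S^j`. -/
def tauStep (j j' m m' : ℤ) (hj : j' = j + 1) (hm : m' = m + 1) :
    X.sphereValue j' m' ⟶ X.sphereValue j m :=
  (X.desusp (-j') (-j) m' (by omega)).app (op E.sphereZero) ≫
    (X.enriched (-j) m').toLoop E.sphereZero (X.deltaGenerated _ _ _) ≫
    mkHom (X.deloop (-j) m m' hm _).symm (Homeomorph.continuous _)
      ((Homeomorph.symm_apply_eq _).2 (X.deloop_pt _ _ _ _ _).symm)

/-- The space whose `π₂` is the bigraded homotopy group `π_{a,b} X = π_{-b} X(S^{a+b})`, for the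
stem `a` and the weight `j = a + b`: the `b+2`-nd space of `X(S^j)`.
Multiplication by `τ` preserves the stem and lowers the weight by one. -/
def G (a j : ℤ) : PtdTop.{u} := X.sphereValue j (j - a + 2)

/-- The map `τ` from weight `q + 1` to weight `q`. -/
def tauG (a q : ℤ) : X.G a (q + 1) ⟶ X.G a q :=
  X.tauStep q (q + 1) (q - a + 2) (q + 1 - a + 2) rfl (by omega)

/-- The power `τ^k` on `G`. -/
def tauPow (a : ℤ) : (k : ℕ) → (p q : ℤ) → p = q + k → (X.G a p ⟶ X.G a q)
  | 0, p, q, h => eqToHom (by simp [h])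
  | k + 1, p, q, h => tauPow a k p (q + 1) (by push_cast at h; omega) ≫ X.tauG a q

/-- The map `τ^{p-q}` from weight `p` to weight `q`. -/
def tau (a p q : ℤ) (h : q ≤ p) : X.G a p ⟶ X.G a q :=
  X.tauPow a (p - q).toNat p q (by omega)

theorem tauPow_add (a : ℤ) (k l n : ℕ) (p q r : ℤ) (h : p = q + k) (h' : q = r + l)
    (h'' : p = r + n) : X.tauPow a n p r h'' = X.tauPow a k p q h ≫ X.tauPow a l q r h' := by
  induction l generalizing n r with
  | zero =>
    obtain rfl : q = r := by simpa using h'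
    obtain rfl : n = k := by omega
    simp [tauPow]
  | succ l ih =>
    obtain ⟨n, rfl⟩ : ∃ n', n = n' + 1 := ⟨n - 1, by push_cast at *; omega⟩
    rw [tauPow, tauPow, ih n (r + 1) (by push_cast at h'; omega) (by push_cast at h''; omega),
      Category.assoc]

theorem tau_comp (a p q r : ℤ) (h : q ≤ p) (h' : r ≤ q) :
    X.tau a p q h ≫ X.tau a q r h' = X.tau a p r (h'.trans h) :=
  (X.tauPow_add a _ _ _ p q r _ _ _).symm

/-- `π_{a,b} X` for the stem `a` and the weight `j = a + b`. -/
abbrev pi (a j : ℤ) : Type u := Pi2 (X.G a j)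

/-- `π_{a,b} (X/τ^k)` for the stem `a`, the weight `q = a + b`, and `k = p - q`.

`X/τ^k` is the cofibre of `τ^k : Σ^{0,-k} X → X`, so it is the suspension of the homotopy fibre
of `τ^k`. -/
abbrev piMod (a q p : ℤ) (h : q ≤ p) : Type u := Pi2 (hofib (X.tau (a - 1) p q h))

/-- `τ^{p-q} : π X → π X`, from weight `p` to weight `q`. -/
def mulTau (a p q : ℤ) (h : q ≤ p) : X.pi a p → X.pi a q := pi2Map (X.tau a p q h)

/-- The reduction `r_k : π X → π (X/τ^k)`, with `k = p - q`. Here the space `G a q` is identified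
with the loop space of `G (a-1) q`, whose loop space maps to the homotopy fibre. -/
def red (a q p : ℤ) (h : q ≤ p) : X.pi a q → X.piMod a q p h :=
  pi2Map (mkHom (X.deloop (-q) (q - a + 2) (q - (a - 1) + 2) (by omega) (op E.sphereZero))
      (Homeomorph.continuous _) (X.deloop_pt _ _ _ _ _) ≫
    loopToHofib (X.tau (a - 1) p q h))

/-- The boundary map `δ_k : π_{a,b} (X/τ^k) → π_{a-1,b+k+1} X`, with `k = p - q`: it lowers the
stem by one, and raises the weight from `q` to `p`. -/
def delta (a q p : ℤ) (h : q ≤ p) : X.piMod a q p h → X.pi (a - 1) p :=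
  pi2Map (hofibFst (X.tau (a - 1) p q h))

/-- The reduction `r_{n,k} : π (X/τ^n) → π (X/τ^k)`, with `n = p - q` and `k = p' - q`. -/
def redMod (a q p p' : ℤ) (h : q ≤ p') (h' : p' ≤ p) :
    X.piMod a q p (h.trans h') → X.piMod a q p' h :=
  pi2Map (hofibMap (X.tau (a - 1) p p' h') (𝟙 _) (by rw [X.tau_comp]; exact Category.comp_id _))

/-- The map `τ^s : π (X/τ^{k}) → π (X/τ^{k+s})`, with `k = p - q'` and `s = q' - q`. -/
def mulTauMod (a q q' p : ℤ) (h : q ≤ q') (h' : q' ≤ p) :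
    X.piMod a q' p h' → X.piMod a q p (h.trans h') :=
  pi2Map (hofibMap (𝟙 _) (X.tau (a - 1) q' q h) (by rw [X.tau_comp]; exact (Category.id_comp _).symm))

namespace Hom

variable {X} {Y : SyntheticSpectrum.{u} E} (f : Hom X Y)

/-- The map induced by a strict map of synthetic spectra on the spaces `G`. -/
def mapG (a j : ℤ) : X.G a j ⟶ Y.G a j := (f.app (-j) (j - a + 2)).app (op E.sphereZero)

theorem loopAt_app (n m : ℤ) (A : E.FP) (y : (X.obj n m).obj (op (E.suspFP.obj A))) (t : I) :
    (Y.enriched n m).loopAt A ((f.app n m).app _ y) t =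
      (f.app n m).app _ ((X.enriched n m).loopAt A y t) := by
  change (Y.obj n m).map _ ((f.app n m).app _ y) = (f.app n m).app _ ((X.obj n m).map _ y)
  rw [← PtdTop.comp_apply, ← PtdTop.comp_apply, (f.app n m).naturality]

theorem mapG_tauG (a q : ℤ) : X.tauG a q ≫ f.mapG a q = f.mapG a (q + 1) ≫ Y.tauG a q := by
  refine PtdTop.hom_ext fun x => ?_
  have hm : q + 1 - a + 2 = q - a + 2 + 1 := by omega
  refine (Y.deloop (-q) (q - a + 2) (q + 1 - a + 2) hm _).injective ?_
  have e1 : Y.deloop (-q) (q - a + 2) (q + 1 - a + 2) hm _ ((f.mapG a (q + 1) ≫ Y.tauG a q) x) =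
      loopMk ((Y.enriched _ _).loopAt E.sphereZero ((Y.desusp (-(q + 1)) (-q) (q + 1 - a + 2)
        (by omega)).app (op E.sphereZero) (f.mapG a (q + 1) x))) :=
    Homeomorph.apply_symm_apply _ _
  have e2 : X.deloop (-q) (q - a + 2) (q + 1 - a + 2) hm _ (X.tauG a q x) =
      loopMk ((X.enriched _ _).loopAt E.sphereZero ((X.desusp (-(q + 1)) (-q) (q + 1 - a + 2)
        (by omega)).app (op E.sphereZero) x)) :=
    Homeomorph.apply_symm_apply _ _
  rw [e1]
  refine congrArg loopMk (a₁ := loopPath _) (Path.ext (funext fun t => ?_))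
  refine (f.app_deloop _ _ _ hm _ (X.tauG a q x) t).trans ?_
  rw [e2]
  refine (f.loopAt_app _ _ _ _ t).symm.trans ?_
  exact congrArg (fun z => (Y.enriched _ _).loopAt E.sphereZero z t)
    (f.app_desusp (-(q + 1)) (-q) (q + 1 - a + 2) (by omega) (op E.sphereZero) x).symm

theorem mapG_tauPow (a : ℤ) (k : ℕ) (p q : ℤ) (h : p = q + k) :
    X.tauPow a k p q h ≫ f.mapG a q = f.mapG a p ≫ Y.tauPow a k p q h := by
  induction k generalizing q with
  | zero =>
    obtain rfl : p = q := by simpa using h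
    simp [tauPow]
  | succ k ih =>
    rw [tauPow, tauPow, Category.assoc, f.mapG_tauG, ← Category.assoc,
      ih (q + 1) (by push_cast at h; omega), Category.assoc]

theorem mapG_tau (a p q : ℤ) (h : q ≤ p) :
    X.tau a p q h ≫ f.mapG a q = f.mapG a p ≫ Y.tau a p q h :=
  f.mapG_tauPow a _ p q _

/-- The map induced on homotopy groups. -/
def mapPi (a j : ℤ) : X.pi a j → Y.pi a j := pi2Map (f.mapG a j)

/-- The map induced on the homotopy groups of `X/τ^{p-q} → Y/τ^{p-q}`. -/
def mapMod (a q p : ℤ) (h : q ≤ p) : X.piMod a q p h → Y.piMod a q p h :=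
  pi2Map (hofibMap (f.mapG (a - 1) p) (f.mapG (a - 1) q) (f.mapG_tau _ p q h))

end Hom

namespace Map

variable {X} {Y : SyntheticSpectrum.{u} E} (α : Map X Y)

/-- `α.Pi x y` says that `α x = y` in `π Y`, for `x` in `π X`. (The map on homotopy groups induced
by `α.left` is bijective.) -/
def Pi {a j : ℤ} (x : X.pi a j) (y : Y.pi a j) : Prop :=
  ∃ u, α.left.mapPi a j u = x ∧ α.right.mapPi a j u = y

/-- `α.Mod x y` says that `α x = y` in `π (Y/τ^k)`, for `x` in `π (X/τ^k)`. -/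
def Mod {a q p : ℤ} {h : q ≤ p} (x : X.piMod a q p h) (y : Y.piMod a q p h) : Prop :=
  ∃ u, α.left.mapMod a q p h u = x ∧ α.right.mapMod a q p h u = y

end Map

/-! ### The `τ`-Bockstein spectral sequence and hidden extensions -/

/-- The group `π_{a,b} (X/τ)`, `j = a + b`: the `E₂` page of the Adams spectral sequence of `X`. -/
abbrev modTau (a j : ℤ) : Type u := X.piMod a j (j + 1) (by omega)

/-- `x` survives to the `E_r` page: the boundary `δ x` is divisible by `τ^{r-2}`. -/
def SurvivesTo (r : ℕ) (hr : 2 ≤ r) {a j : ℤ} (x : X.modTau a j) : Prop :=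
  ∃ y : X.pi (a - 1) (j + r - 1),
    X.mulTau (a - 1) (j + r - 1) (j + 1) (by omega) y = X.delta a j (j + 1) (by omega) x

/-- `x` survives to the `E_r` page, and `d` is a representative, on the `E₂` page, of `d_r x`
(with the change of sign): `d` is the negative of the reduction of some `y` with
`τ^{r-2} y = δ x`. The target has stem `a - 1` and weight `j' = j + r - 1`. -/
def IsDifferential (r : ℕ) (hr : 2 ≤ r) {a j j' : ℤ} (hj : j' = j + r - 1) (x : X.modTau a j)
    (d : X.modTau (a - 1) j') : Prop :=
  ∃ y : X.pi (a - 1) j',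
    X.mulTau (a - 1) j' (j + 1) (by omega) y = X.delta a j (j + 1) (by omega) x ∧
      d = -X.red (a - 1) j' (j' + 1) (by omega) y

namespace Map

variable {X} {Y : SyntheticSpectrum.{u} E} (α : Map X Y)

/-- There is a maximal hidden `α`-extension by `s` from `x` to `y` on the `E_r` page, `r < ∞`:
there are lifts `x'` of `x` to `X/τ^{r-1}` and `y'` of `y` to `Y/τ^{r-1-s}` with
`α x' = τ^s y'`, and `α x'` is not divisible by `τ^{s+1}`. (The last condition is void if
`r = s + 2`.) -/
def IsMaximalExtension (r s : ℕ) (hs : s + 1 < r) {a j : ℤ} (x : X.modTau a j)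
    (y : Y.modTau a (j + s)) : Prop :=
  ∃ (x' : X.piMod a j (j + r - 1) (by omega)) (y' : Y.piMod a (j + s) (j + r - 1) (by omega)),
    X.redMod a j (j + r - 1) (j + 1) (by omega) (by omega) x' = x ∧
    Y.redMod a (j + s) (j + r - 1) (j + s + 1) (by omega) (by omega) y' = y ∧
    ∃ w, α.Mod x' w ∧ w = Y.mulTauMod a j (j + s) (j + r - 1) (by omega) (by omega) y' ∧
      ∀ h : s + 2 < r, ∀ z : Y.piMod a (j + s + 1) (j + r - 1) (by omega),
        w ≠ Y.mulTauMod a j (j + s + 1) (j + r - 1) (by omega) (by omega) z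

/-- There is a maximal hidden `α`-extension by `s < ∞` from `x` to `y` on the `E_∞` page:
there are lifts `x'` of `x` to `X` and `y'` of `y` to `Y` with `α x' = τ^s y'`,
and `α x'` is not divisible by `τ^{s+1}`. -/
def IsMaximalExtensionInfty (s : ℕ) {a j : ℤ} (x : X.modTau a j) (y : Y.modTau a (j + s)) :
    Prop :=
  ∃ (x' : X.pi a j) (y' : Y.pi a (j + s)),
    X.red a j (j + 1) (by omega) x' = x ∧
    Y.red a (j + s) (j + s + 1) (by omega) y' = y ∧
    ∃ w, α.Pi x' w ∧ w = Y.mulTau a (j + s) j (by omega) y' ∧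
      ∀ z : Y.pi a (j + s + 1), w ≠ Y.mulTau a (j + s + 1) j (by omega) z

/-- There is a maximal hidden `α`-extension by `∞` from `x` to `0` on the `E_∞` page: there is a
lift `x'` of `x` to `X` such that `α x'` is divisible by all powers of `τ`. -/
def HasInfiniteExtension {a j : ℤ} (x : X.modTau a j) : Prop :=
  ∃ x' : X.pi a j, X.red a j (j + 1) (by omega) x' = x ∧
    ∃ w, α.Pi x' w ∧ ∀ s : ℕ, ∃ z : Y.pi a (j + s), w = Y.mulTau a (j + s) j (by omega) z

end Map

end SyntheticSpectrum

/-! The differential and the extension are both read off from one truncated lift of `x`. If `δ x =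
τ^{r-2} y₀`, then `x` lifts to some `x'` in `π (X/τ^{r-1})` with `δ x' = y₀` (`exists_lift`). Write
`w = α x' = τ^s y'` with `s` as large as possible; the reduction `y` of `y'` modulo `τ` is then a
maximal extension of `x`. Boundary maps commute with `α`, ignore `τ^s : Y/τ^{r-1-s} → Y/τ^{r-1}`,
and turn reduction of the modulus into multiplication by `τ`, so `δ y = τ^{r-2-s} δ w` with `δ w = α
y₀`.

Since `d = -r_1(y₀)`, the element `-y₀` is a lift of `d` and its image under `α` is `-δ w`. If `-δ w
= τ^{s'} z` with `s'` maximal, then `z` reduces to a maximal extension of `d`, and `δ y =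
τ^{r-2-s+s'} (-z)` says that `d_{r+s'-s}(y)` is represented by that reduction. If `-δ w` is
divisible by all powers of `τ`, so is `δ y`, and every differential on `y` has `0` as a
representative.

The remaining work derives the needed part of the exact sequence of `τ^k` from point-set models:
exactness at the source of `τ^k` (`exists_delta_eq`), exactness at `π (X/τ^k)` (`exists_red_eq`),
and `r_1 τ = 0` (`red_mulTau`). The last is the delicate one: `τ` commutes with delooping only after
two loop coordinates are exchanged, and the exchange, which reverses a loop, is realised by rotating
a square. -/

namespace PtdTop

/-! ### Representatives of elements of the second homotopy group -/

/-- The class of a square in the second homotopy group. -/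
def squareClass {Z : PtdTop.{u}} (p : GenLoop (Fin 2) Z Z.pt) : Pi2 Z :=
  Additive.ofMul (Quotient.mk _ p)

theorem exists_squareClass {Z : PtdTop.{u}} (x : Pi2 Z) : ∃ p, squareClass p = x := by
  obtain ⟨p, hp⟩ := Quotient.exists_rep x.toMul
  exact ⟨p, hp⟩

/-- The image of a square under a pointed map. -/
def mapSquare {Z W : PtdTop.{u}} (f : Z ⟶ W) (p : GenLoop (Fin 2) Z Z.pt) :
    GenLoop (Fin 2) W W.pt :=
  ⟨f.toMap.comp p.1, fun y hy => by rw [ContinuousMap.comp_apply, p.2 y hy, f.map_pt]⟩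

theorem pi2Map_squareClass {Z W : PtdTop.{u}} (f : Z ⟶ W) (p : GenLoop (Fin 2) Z Z.pt) :
    pi2Map f (squareClass p) = squareClass (mapSquare f p) := rfl

/-- Build a square from a continuous function. -/
def mkSquare {Z : PtdTop.{u}} (f : (Fin 2 → I) → Z) (hf : Continuous f)
    (h : ∀ c ∈ Cube.boundary (Fin 2), f c = Z.pt) : GenLoop (Fin 2) Z Z.pt :=
  ⟨⟨f, hf⟩, h⟩

theorem squareClass_eq {Z : PtdTop.{u}} {p q : GenLoop (Fin 2) Z Z.pt}
    (H : I × (Fin 2 → I) → Z) (hH : Continuous H) (h0 : ∀ c, H (0, c) = p c)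
    (h1 : ∀ c, H (1, c) = q c) (hb : ∀ t, ∀ c ∈ Cube.boundary (Fin 2), H (t, c) = Z.pt) :
    squareClass p = squareClass q := by
  refine congrArg Additive.ofMul (Quotient.sound ⟨⟨⟨⟨H, hH⟩, h0, h1⟩, fun t c hc => ?_⟩⟩)
  exact (hb t c hc).trans (p.2 c hc).symm

theorem exists_homotopy_of_squareClass_eq {Z : PtdTop.{u}} {p q : GenLoop (Fin 2) Z Z.pt}
    (h : squareClass p = squareClass q) :
    ∃ H : I × (Fin 2 → I) → Z, Continuous H ∧ (∀ c, H (0, c) = p c) ∧ (∀ c, H (1, c) = q c) ∧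
      ∀ t, ∀ c ∈ Cube.boundary (Fin 2), H (t, c) = Z.pt := by
  obtain ⟨H⟩ := Quotient.exact (Additive.ofMul.injective h)
  exact ⟨H, H.continuous, H.apply_zero, H.apply_one, fun t c hc =>
    (H.eq_fst t hc).trans (p.2 c hc)⟩

theorem squareClass_const {Z : PtdTop.{u}} :
    squareClass (GenLoop.const : GenLoop (Fin 2) Z Z.pt) = 0 := rfl

theorem pi2Map_comp {A B C : PtdTop.{u}} (f : A ⟶ B) (g : B ⟶ C) (x : Pi2 A) :
    pi2Map (f ≫ g) x = pi2Map g (pi2Map f x) := by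
  obtain ⟨p, rfl⟩ := exists_squareClass x
  rfl

theorem pi2Map_id {A : PtdTop.{u}} (x : Pi2 A) : pi2Map (𝟙 A) x = x := by
  obtain ⟨p, rfl⟩ := exists_squareClass x
  rfl

theorem squareClass_add {Z : PtdTop.{u}} (p q : GenLoop (Fin 2) Z Z.pt) :
    squareClass p + squareClass q = squareClass (GenLoop.transAt 0 q p) :=
  -- The group law on cubes composes in the opposite order to concatenation, hence the swap of `p`
  -- and `q`.
  congrArg Additive.ofMul (HomotopyGroup.mul_spec (i := (0 : Fin 2)) (p := p) (q := q))

theorem mapSquare_transAt {Z W : PtdTop.{u}} (f : Z ⟶ W) (p q : GenLoop (Fin 2) Z Z.pt) :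
    mapSquare f (GenLoop.transAt 0 p q) = GenLoop.transAt 0 (mapSquare f p) (mapSquare f q) :=
  GenLoop.ext _ _ fun _ => apply_ite f.toMap _ _ _

/-- The additive map induced on second homotopy groups. -/
noncomputable def pi2Hom {Z W : PtdTop.{u}} (f : Z ⟶ W) : Pi2 Z →+ Pi2 W :=
  AddMonoidHom.mk' (pi2Map f) fun x y => by
    obtain ⟨p, rfl⟩ := exists_squareClass x
    obtain ⟨q, rfl⟩ := exists_squareClass y
    rw [squareClass_add, pi2Map_squareClass, pi2Map_squareClass, pi2Map_squareClass,
      squareClass_add, mapSquare_transAt]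

theorem pi2Map_zero {Z W : PtdTop.{u}} (f : Z ⟶ W) : pi2Map f 0 = 0 := map_zero (pi2Hom f)

theorem pi2Map_add {Z W : PtdTop.{u}} (f : Z ⟶ W) (x y : Pi2 Z) :
    pi2Map f (x + y) = pi2Map f x + pi2Map f y := map_add (pi2Hom f) x y

theorem pi2Map_neg {Z W : PtdTop.{u}} (f : Z ⟶ W) (x : Pi2 Z) :
    pi2Map f (-x) = -pi2Map f x := map_neg (pi2Hom f) x

theorem pi2Map_sub {Z W : PtdTop.{u}} (f : Z ⟶ W) (x y : Pi2 Z) :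
    pi2Map f (x - y) = pi2Map f x - pi2Map f y := map_sub (pi2Hom f) x y

theorem pi2Map_zero_map {Z W : PtdTop.{u}} (x : Pi2 Z) : pi2Map (zero Z W) x = 0 := by
  obtain ⟨p, rfl⟩ := exists_squareClass x
  rfl

/-- `IsWeakEquiv` uses `f z` as base point of the target, while `pi2Map` uses the chosen base point,
which equals it only propositionally. -/
theorem piMap_bijective_of_isWeakEquiv {Z W : PtdTop.{u}} {f : Z ⟶ W} (hf : IsWeakEquiv f) (n : ℕ)
    (z : Z) (w : W) (h : f.toMap z = w) : Function.Bijective (piMap f.toMap n h) := by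
  subst h
  exact hf n z

theorem pi2Map_bijective {Z W : PtdTop.{u}} {f : Z ⟶ W} (hf : IsWeakEquiv f) :
    Function.Bijective (pi2Map f) :=
  piMap_bijective_of_isWeakEquiv hf 2 Z.pt W.pt f.map_pt

/-! ### Cubes are delta-generated -/

/-- A retraction is a quotient map. Delta-generation of cubes is needed because `loop` carries the
delta-generated topology: continuity into it can be tested in the path space when the source is
delta-generated. -/
theorem deltaGenerated_of_retract {n : ℕ} {T : Type*} [TopologicalSpace T] (i : T → Fin n → ℝ)
    (ρ : (Fin n → ℝ) → T) (hi : Continuous i) (hρ : Continuous ρ) (h : ∀ x, ρ (i x) = x) :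
    DeltaGeneratedSpace T :=
  (IsQuotientMap.of_inverse hi hρ h).isGeneratedBy

theorem deltaGenerated_square : DeltaGeneratedSpace (Fin 2 → I) :=
  deltaGenerated_of_retract (fun c k => (c k : ℝ)) (fun y k => Set.projIcc 0 1 zero_le_one (y k))
    (by fun_prop) (continuous_pi fun k => continuous_projIcc.comp (continuous_apply k))
    fun c => funext fun k => Set.projIcc_val _ _

theorem deltaGenerated_fourCube : DeltaGeneratedSpace ((I × (Fin 2 → I)) × I) :=
  deltaGenerated_of_retract (fun x => ![(x.1.1 : ℝ), x.1.2 0, x.1.2 1, x.2])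
    (fun y => ((Set.projIcc 0 1 zero_le_one (y 0), ![Set.projIcc 0 1 zero_le_one (y 1),
      Set.projIcc 0 1 zero_le_one (y 2)]), Set.projIcc 0 1 zero_le_one (y 3)))
    (by
      refine continuous_pi fun k => ?_
      fin_cases k <;> simp <;> fun_prop)
    (by
      have (k : Fin 4) : Continuous fun y : Fin 4 → ℝ => Set.projIcc (0 : ℝ) 1 zero_le_one (y k) :=
        continuous_projIcc.comp (continuous_apply k)
      refine ((this 0).prodMk (continuous_pi fun k => ?_)).prodMk (this 3)
      fin_cases k
      exacts [this 1, this 2])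
    fun x => by
      refine Prod.ext (Prod.ext (Set.projIcc_val zero_le_one _) (funext fun k => ?_))
        (Set.projIcc_val zero_le_one _)
      fin_cases k <;> exact Set.projIcc_val zero_le_one _

/-! ### The exact sequence of a homotopy fibre -/

/-- The point of the homotopy fibre given by a point of the source and a path. -/
def hofibMk {Z W : PtdTop.{u}} (p : Z ⟶ W) (z : Z) (γ : C(I, W)) (h0 : γ 0 = W.pt)
    (h1 : γ 1 = p z) : hofib p := ⟨(z, γ), h0, h1⟩

theorem hofib_ext {Z W : PtdTop.{u}} {p : Z ⟶ W} {x y : hofib p} (h : x.1.1 = y.1.1)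
    (h' : ∀ t, x.1.2 t = y.1.2 t) : x = y :=
  Subtype.ext (Prod.ext h (ContinuousMap.ext h'))

theorem continuous_hofibMk {Z W : PtdTop.{u}} (p : Z ⟶ W) {T : Type*} [TopologicalSpace T]
    (z : T → Z) (γ : C(T, C(I, W))) (h0 : ∀ x, γ x 0 = W.pt) (h1 : ∀ x, γ x 1 = p (z x))
    (hz : Continuous z) : Continuous fun x => hofibMk p (z x) (γ x) (h0 x) (h1 x) :=
  Continuous.subtype_mk (hz.prodMk γ.continuous) _

/-- Curry a continuous function into a family of paths. -/
def pathFamily {T W : Type*} [TopologicalSpace T] [TopologicalSpace W] (F : T × I → W)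
    (hF : Continuous F) : C(T, C(I, W)) := ContinuousMap.curry ⟨F, hF⟩

/-- A null-homotopy of `p ∘ g`, run from the base point to `p ∘ g`, supplies exactly the paths that
lift `g` to the homotopy fibre. -/
theorem pi2Map_hofibFst_surjective {Z W : PtdTop.{u}} (p : Z ⟶ W) (x : Pi2 Z)
    (hx : pi2Map p x = 0) : ∃ w, pi2Map (hofibFst p) w = x := by
  obtain ⟨g, rfl⟩ := exists_squareClass x
  rw [pi2Map_squareClass, ← squareClass_const] at hx
  obtain ⟨H, hH, h0, h1, hb⟩ := exists_homotopy_of_squareClass_eq hx.symm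
  refine ⟨squareClass (mkSquare (Z := hofib p) (fun c => hofibMk p (g c)
    (pathFamily (fun x : (Fin 2 → I) × I => H (x.2, x.1)) (by fun_prop) c) (h0 c) (h1 c))
    (continuous_hofibMk _ _ _ _ _ g.1.continuous) fun c hc => ?_), ?_⟩
  · exact hofib_ext (g.2 c hc) fun t => hb t c hc
  · rfl

/-- Contracting the `Z`-component, while the path is prolonged by the image of the contraction,
drags the square into the fibre over the base point, which consists of loops in `W`. -/
theorem pi2Map_loopToHofib_surjective {Z W : PtdTop.{u}} (p : Z ⟶ W) (x : Pi2 (hofib p))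
    (hx : pi2Map (hofibFst p) x = 0) : ∃ w, pi2Map (loopToHofib p) w = x := by
  obtain ⟨g, rfl⟩ := exists_squareClass x
  rw [pi2Map_squareClass, ← squareClass_const] at hx
  obtain ⟨K, hK, h0, h1, hb⟩ := exists_homotopy_of_squareClass_eq hx
  have hg : Continuous g := g.1.continuous
  have hp : Continuous p := continuous_hom p
  have K0 (c) : K (0, c) = (g c).1.1 := h0 c
  have K1 (c) : K (1, c) = Z.pt := h1 c
  let P : ℝ → I := Set.projIcc 0 1 zero_le_one
  have hP : Continuous P := continuous_projIcc
  have P0 : P 0 = 0 := Set.projIcc_left _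
  have P1 : P 1 = 1 := Set.projIcc_right _
  have PI (t : I) : P t = t := Set.projIcc_val _ _
  -- The given path on `[0, 1]`, followed on `[1, 2]` by the image under `p` of the contraction `K`.
  let Γ : (Fin 2 → I) × ℝ → W := fun y => if y.2 ≤ 1 then (g y.1).1.2 (P y.2) else
    p (K (P (y.2 - 1), y.1))
  have hΓ : Continuous Γ := by
    refine Continuous.if_le ?_ ?_ continuous_snd continuous_const ?_
    · exact (continuous_snd.comp (continuous_subtype_val.comp (hg.comp continuous_fst))).eval
        (hP.comp continuous_snd)
    · fun_prop
    · rintro ⟨c, t⟩ (rfl : t = 1)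
      simp only [sub_self, P0, P1, K0]
      exact (g c).2.2
  have Γ0 (c) : Γ (c, 0) = W.pt := by
    simp only [Γ, zero_le_one, if_true, P0]
    exact (g c).2.1
  have Γend (c) (θ : I) : Γ (c, 1 + θ) = p (K (θ, c)) := by
    by_cases hθ : (θ : ℝ) ≤ 0
    · obtain rfl : θ = 0 := Subtype.ext (le_antisymm hθ θ.2.1)
      simp only [Γ, Set.Icc.coe_zero, add_zero, le_refl, if_true, P1, K0]
      exact (g c).2.2
    · have : ¬ (1 + (θ : ℝ) ≤ 1) := by linarith
      simp only [Γ, this, if_false, add_sub_cancel_left, PI]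
  have Γb (c) (hc : c ∈ Cube.boundary (Fin 2)) (t) : Γ (c, t) = W.pt := by
    have hgc : g c = (hofib p).pt := g.2 c hc
    simp only [Γ, hb _ c hc, p.map_pt, hgc]
    split_ifs <;> rfl
  -- `Γ` stopped at time `1 + θ` and rescaled to `I`. It ends at `p (K (θ, c))`, so the deformation
  -- stays in the homotopy fibre; for `θ = 0` it is the original path, for `θ = 1` a loop.
  let γ : C(I × (Fin 2 → I), C(I, W)) := pathFamily
    (fun y => Γ (y.1.2, (1 + (y.1.1 : ℝ)) * (y.2 : ℝ))) (by fun_prop)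
  have γ0 (y) : γ y 0 = W.pt := by
    change Γ (y.2, _) = _
    rw [Set.Icc.coe_zero, mul_zero, Γ0]
  have γ1 (y) : γ y 1 = p (K y) := by
    change Γ (y.2, _) = _
    rw [Set.Icc.coe_one, mul_one, Γend]
  let lp : (Fin 2 → I) → LoopSpace W W.pt := fun c =>
    ⟨γ (1, c), γ0 _, (γ1 _).trans (by rw [K1, p.map_pt])⟩
  have hlp : Continuous lp := continuous_induced_rng.2
    (γ.continuous.comp (continuous_const.prodMk continuous_id))
  have := deltaGenerated_square
  refine ⟨squareClass (mkSquare (Z := loop W) (fun c => loopMk (lp c)) ?_ ?_), ?_⟩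
  · exact (IsGeneratedBy.equiv_symm_comp_continuous_iff (X := fun n : ℕ => Fin n → ℝ) lp).2 hlp
  · intro c hc
    exact congrArg loopMk (Path.ext (funext fun t => Γb c hc _))
  · symm
    refine squareClass_eq (fun y => hofibMk p (K y) (γ y) (γ0 y) (γ1 y))
      (continuous_hofibMk _ _ _ _ _ hK) (fun c => ?_) (fun c => ?_) fun t c hc => ?_
    · refine hofib_ext (K0 c) fun t => ?_
      change Γ (c, _) = _
      have : (t : ℝ) ≤ 1 := t.2.2
      simp only [Set.Icc.coe_zero, add_zero, one_mul, Γ, this, if_true, PI]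
    · exact hofib_ext (K1 c) fun t => rfl
    · exact hofib_ext (hb _ c hc) fun t => Γb c hc _

theorem pi2Map_hofibFst_loopToHofib {Z W : PtdTop.{u}} (p : Z ⟶ W) (x : Pi2 (loop W)) :
    pi2Map (hofibFst p) (pi2Map (loopToHofib p) x) = 0 := by
  rw [← pi2Map_comp]
  exact pi2Map_zero_map x

/-! ### Rotation of a square -/

/-- A quarter turn of the square, through maps of the square into itself that preserve the
boundary. -/
theorem exists_quarterTurn : ∃ R : I × I × I → I × I, Continuous R ∧
    (∀ t s, R (0, t, s) = (t, s)) ∧ (∀ t s, R (1, t, s) = (s, σ t)) ∧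
    ∀ θ t s, (t = 0 ∨ t = 1 ∨ s = 0 ∨ s = 1) →
      (R (θ, t, s)).1 = 0 ∨ (R (θ, t, s)).1 = 1 ∨ (R (θ, t, s)).2 = 0 ∨ (R (θ, t, s)).2 = 1 := by
  let P : ℝ → I := Set.projIcc 0 1 zero_le_one
  have hP : Continuous P := continuous_projIcc
  have PI (t : I) : P t = t := Set.projIcc_val _ _
  have Pbd (y : ℝ) (h0 : P y ≠ 0) (h1 : P y ≠ 1) : |2 * y - 1| < 1 := by
    rw [abs_lt]
    constructor
    · by_contra h
      exact h0 (Set.projIcc_of_le_left _ (by linarith))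
    · by_contra h
      exact h1 (Set.projIcc_of_right_le _ (by linarith))
  -- In coordinates centred at the middle of the square, the straight line of matrices from the
  -- identity to the quarter turn, enlarged by `k θ` and then clamped to the square. The factor is
  -- `1` at both ends and large enough that `D ≥ 1` below.
  let k : ℝ → ℝ := fun θ => 1 + 4 * θ * (1 - θ)
  let A : ℝ → ℝ → ℝ → ℝ := fun θ a b => k θ * ((1 - θ) * a + θ * b)
  let B : ℝ → ℝ → ℝ → ℝ := fun θ a b => k θ * ((1 - θ) * b - θ * a)
  have key (θ a b : ℝ) (h0 : 0 ≤ θ) (h1 : θ ≤ 1) (hA : |A θ a b| < 1) (hB : |B θ a b| < 1) :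
      |a| < 1 ∧ |b| < 1 := by
    let D : ℝ := k θ * ((1 - θ) ^ 2 + θ ^ 2)
    have hD : 1 ≤ D := by
      have : 0 ≤ θ * (1 - θ) := mul_nonneg h0 (by linarith)
      have e : D = 1 + 2 * (θ * (1 - θ)) * (2 * θ - 1) ^ 2 := by
        simp only [D, k]; ring
      rw [e]; nlinarith [mul_nonneg this (sq_nonneg (2 * θ - 1))]
    -- `D a` and `D b` are convex combinations of `± A` and `± B`. As `D ≥ 1`, a point with image in
    -- the open square lies in the open square; so the boundary stays on the boundary.
    have ea : D * a = (1 - θ) * A θ a b - θ * B θ a b := by simp only [D, A, B]; ring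
    have eb : D * b = (1 - θ) * B θ a b + θ * A θ a b := by simp only [D, A, B]; ring
    have aux (c x y : ℝ) (hx : |x| < 1) (hy : |y| < 1) (hc : D * c = (1 - θ) * x + θ * y) :
        |c| < 1 := by
      rw [abs_lt] at hx hy ⊢
      have h2 : (1 - θ) * x + θ * y < 1 := by
        rcases h0.eq_or_lt with rfl | h0
        · linarith
        · nlinarith
      have h3 : -1 < (1 - θ) * x + θ * y := by
        rcases h0.eq_or_lt with rfl | h0
        · linarith
        · nlinarith
      constructor <;> nlinarith
    refine ⟨aux a _ (-B θ a b) hA (by rwa [abs_neg]) (by rw [ea]; ring), aux b _ _ hB hA eb⟩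
  refine ⟨fun x => (P ((A x.1 (2 * x.2.1 - 1) (2 * x.2.2 - 1) + 1) / 2),
    P ((B x.1 (2 * x.2.1 - 1) (2 * x.2.2 - 1) + 1) / 2)), ?_, ?_, ?_, ?_⟩
  · simp only [A, B, k]
    fun_prop
  · intro t s
    refine Prod.ext ((congrArg P ?_).trans (PI t)) ((congrArg P ?_).trans (PI s)) <;>
      simp [A, B, k]
  · intro t s
    refine Prod.ext ((congrArg P ?_).trans (PI s)) ((congrArg P ?_).trans (PI (σ t))) <;>
      simp [A, B, k]
    ring
  · intro θ t s h
    by_contra! hR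
    obtain ⟨r1, r2, r3, r4⟩ := hR
    have hA := Pbd _ r1 r2
    have hB := Pbd _ r3 r4
    have := key θ (2 * t - 1) (2 * s - 1) θ.2.1 θ.2.2
      (by convert hA using 2; ring) (by convert hB using 2; ring)
    rcases h with rfl | rfl | rfl | rfl <;> norm_num at this

end PtdTop

/-! ### Families of loops and their vanishing in a homotopy fibre -/

namespace PtdTop

theorem continuous_loopMk_comp {Z : PtdTop.{u}} {T : Type*} [TopologicalSpace T]
    [DeltaGeneratedSpace T] {g : T → LoopSpace Z Z.pt} (hg : Continuous g) :
    Continuous fun x => loopMk (g x) :=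
  (IsGeneratedBy.equiv_symm_comp_continuous_iff (X := fun n : ℕ => Fin n → ℝ) g).2 hg

theorem loopPath_pt {Z : PtdTop.{u}} (t : I) : loopPath (loop Z).pt t = Z.pt := rfl

theorem continuous_loopPath_eval {Z : PtdTop.{u}} {T : Type*} [TopologicalSpace T]
    {g : T → loop Z} {t : T → I} (hg : Continuous g) (ht : Continuous t) :
    Continuous fun x => loopPath (g x) (t x) :=
  (continuous_induced_dom.comp ((continuous_loopPath Z).comp hg)).eval ht

theorem loop_ext {Z : PtdTop.{u}} {x y : loop Z} (h : ∀ t, loopPath x t = loopPath y t) : x = y :=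
  congrArg loopMk (a₁ := loopPath x) (a₂ := loopPath y) (Path.ext (funext h))

/-- A family of double loops can be rotated by a quarter turn. -/
theorem exists_rotated_family {W K : PtdTop.{u}} (D : W ≃ₜ loop K) (hD : D W.pt = (loop K).pt)
    (Φ : (Fin 2 → I) → I × I → K) (hΦ : Continuous fun y : (Fin 2 → I) × (I × I) => Φ y.1 y.2)
    (Φb : ∀ c t s, (t = 0 ∨ t = 1 ∨ s = 0 ∨ s = 1) → Φ c (t, s) = K.pt)
    (Φc : ∀ c ∈ Cube.boundary (Fin 2), ∀ y, Φ c y = K.pt) :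
    ∃ A : C(I × (Fin 2 → I), C(I, W)), (∀ c t s, loopPath (D (A (0, c) t)) s = Φ c (t, s)) ∧
      (∀ c t s, loopPath (D (A (1, c) t)) s = Φ c (s, σ t)) ∧
      (∀ y, A y 0 = W.pt) ∧ (∀ y, A y 1 = W.pt) ∧
      ∀ c ∈ Cube.boundary (Fin 2), ∀ θ t, A (θ, c) t = W.pt := by
  obtain ⟨R, hR, R0, R1, Rb⟩ := exists_quarterTurn
  let F : C((I × (Fin 2 → I)) × I, C(I, K)) :=
    pathFamily (fun z => Φ z.1.1.2 (R (z.1.1.1, z.1.2, z.2))) (hΦ.comp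
      (f := fun z : ((I × (Fin 2 → I)) × I) × I => (z.1.1.2, R (z.1.1.1, z.1.2, z.2)))
      (by fun_prop))
  let lp : (I × (Fin 2 → I)) × I → LoopSpace K K.pt := fun y =>
    ⟨F y, Φb _ _ _ (Rb _ _ _ (.inr (.inr (.inl rfl)))),
      Φb _ _ _ (Rb _ _ _ (.inr (.inr (.inr rfl))))⟩
  have hlp : Continuous lp := continuous_induced_rng.2 F.continuous
  -- The loops in `K` depend on four coordinates: the rotation parameter, two for `c`, and the outer
  -- loop time.
  have := deltaGenerated_fourCube
  have lp_pt (y) (h : ∀ s, Φ y.1.2 (R (y.1.1, y.2, s)) = K.pt) :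
      D.symm (loopMk (lp y)) = W.pt := by
    rw [Homeomorph.symm_apply_eq, hD]
    exact loop_ext h
  refine ⟨pathFamily (fun y => D.symm (loopMk (lp y)))
      (D.symm.continuous.comp (continuous_loopMk_comp hlp)), fun c t s => ?_, fun c t s => ?_,
      fun y => lp_pt _ fun s => Φb _ _ _ (Rb _ _ _ (.inl rfl)),
      fun y => lp_pt _ fun s => Φb _ _ _ (Rb _ _ _ (.inr (.inl rfl))),
      fun c hc θ t => lp_pt _ fun s => Φc c hc _⟩
  · change loopPath (D (D.symm (loopMk (lp ((0, c), t))))) s = _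
    rw [D.apply_symm_apply]
    exact congrArg (Φ c) (R0 t s)
  · change loopPath (D (D.symm (loopMk (lp ((1, c), t))))) s = _
    rw [D.apply_symm_apply]
    exact congrArg (Φ c) (R1 t s)

/-- A family of loops in `W` that is homotopic to the reverse of the image of a family of loops
in `Z` vanishes in the homotopy fibre of `Z → W`. -/
theorem squareClass_hofib_eq_zero {Z W : PtdTop.{u}} (p : Z ⟶ W)
    (q : GenLoop (Fin 2) (hofib p) (hofib p).pt) (A : C(I × (Fin 2 → I), C(I, W)))
    (ζ : (Fin 2 → I) → I → Z) (hζ : Continuous fun y : (Fin 2 → I) × I => ζ y.1 y.2)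
    (q0 : ∀ c, (q c).1.1 = Z.pt) (A0 : ∀ c t, A (0, c) t = (q c).1.2 t)
    (A1 : ∀ c t, A (1, c) t = p (ζ c (σ t))) (As : ∀ y, A y 0 = W.pt) (At : ∀ y, A y 1 = W.pt)
    (Ab : ∀ c ∈ Cube.boundary (Fin 2), ∀ θ t, A (θ, c) t = W.pt)
    (ζs : ∀ c, ζ c 0 = Z.pt) (ζt : ∀ c, ζ c 1 = Z.pt)
    (ζb : ∀ c ∈ Cube.boundary (Fin 2), ∀ t, ζ c t = Z.pt) : squareClass q = 0 := by
  have hp : Continuous p := continuous_hom p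
  -- First stage: only the path moves, from that of `q c` to the reversed image of `ζ c`.
  let H₁ : I × (Fin 2 → I) → hofib p := fun y => hofibMk p Z.pt (A y) (As y)
    ((At y).trans p.map_pt.symm)
  have hH₁ : Continuous H₁ := continuous_hofibMk _ _ _ _ _ continuous_const
  have H₁b (t c) (hc : c ∈ Cube.boundary (Fin 2)) : H₁ (t, c) = (hofib p).pt :=
    hofib_ext rfl fun t' => Ab c hc t t'
  -- Second stage: the point of `Z` travels along `ζ c`, and the path is the image of `ζ c` run
  -- backwards from time `1` to the current time. At the end nothing of it remains.
  let B : C(I × (Fin 2 → I), C(I, W)) :=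
    pathFamily (fun y => p (ζ y.1.2 (σ (y.2 * σ y.1.1)))) 
      (hp.comp (hζ.comp (f := fun y : (I × (Fin 2 → I)) × I => (y.1.2, σ (y.2 * σ y.1.1)))
        (by fun_prop)))
  have Be (y t) : B y t = p (ζ y.2 (σ (t * σ y.1))) := rfl
  let H₂ : I × (Fin 2 → I) → hofib p := fun y => hofibMk p (ζ y.2 y.1) (B y)
    (by rw [Be, zero_mul, unitInterval.symm_zero, ζt, p.map_pt])
    (by rw [Be, one_mul, unitInterval.symm_symm])
  have hH₂ : Continuous H₂ := continuous_hofibMk _ _ _ _ _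
    (hζ.comp (continuous_snd.prodMk continuous_fst))
  have H₂b (t c) (hc : c ∈ Cube.boundary (Fin 2)) : H₂ (t, c) = (hofib p).pt :=
    hofib_ext (ζb c hc t) fun t' => (congrArg p (ζb c hc _)).trans p.map_pt
  rw [← squareClass_const]
  refine (squareClass_eq (q := mkSquare (Z := hofib p) (fun c => H₁ (1, c)) (by fun_prop)
    (H₁b 1)) H₁ hH₁ (fun c => hofib_ext (q0 c).symm (A0 c)) (fun c => rfl) H₁b).trans
    (squareClass_eq H₂ hH₂ (fun c => ?_) (fun c => ?_) H₂b)
  · refine hofib_ext (ζs c) fun t => ?_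
    refine Eq.trans ?_ (A1 c t).symm
    change B (0, c) t = _
    rw [Be, unitInterval.symm_zero, mul_one]
  · refine hofib_ext (ζt c) fun t => ?_
    change B (1, c) t = _
    rw [Be, unitInterval.symm_one, mul_zero, unitInterval.symm_zero, ζt, p.map_pt]
    rfl

/-- The path component of the homotopy fibre is itself the null-homotopy. -/
theorem pi2Map_hofibFst {Z W : PtdTop.{u}} (p : Z ⟶ W) (x : Pi2 (hofib p)) :
    pi2Map p (pi2Map (hofibFst p) x) = 0 := by
  obtain ⟨g, rfl⟩ := exists_squareClass x
  have hg : Continuous g := g.1.continuous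
  rw [pi2Map_squareClass, pi2Map_squareClass, ← squareClass_const]
  refine (squareClass_eq (fun y => (g y.2).1.2 y.1) ?_ (fun c => (g c).2.1)
    (fun c => (g c).2.2) fun t c hc => ?_).symm
  · exact (continuous_snd.comp (continuous_subtype_val.comp (hg.comp continuous_snd))).eval
      continuous_fst
  · exact congrArg (fun y : hofib p => y.1.2 t) (g.2 c hc)

end PtdTop

/-! ### Multiples of `τ` vanish modulo `τ` -/

namespace SyntheticSpectrum

variable {E : HomologyTheory.{v}} (X : SyntheticSpectrum.{u} E)

/-- The structure map `X_m → Ω X_{m+1}` as a pointed map. -/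
def deloopHom (n m m' : ℤ) (h : m' = m + 1) (A : E.FPᵒᵖ) :
    (X.obj n m).obj A ⟶ loop ((X.obj n m').obj A) :=
  mkHom (X.deloop n m m' h A) (Homeomorph.continuous _) (X.deloop_pt _ _ _ _ _)

/-- The identification of `G a q` with the loop space of `G (a - 1) q`. -/
def deloopG (a q : ℤ) : X.G a q ⟶ loop (X.G (a - 1) q) :=
  X.deloopHom (-q) (q - a + 2) (q - (a - 1) + 2) (by omega) (op E.sphereZero)

theorem red_eq (a q p : ℤ) (h : q ≤ p) (x : X.pi a q) :
    X.red a q p h x = pi2Map (loopToHofib (X.tau (a - 1) p q h)) (pi2Map (X.deloopG a q) x) := by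
  obtain ⟨g, rfl⟩ := exists_squareClass x
  rfl

/-- Reduction modulo `τ` vanishes on multiples of `τ`. -/
theorem pi2Map_loopToHofib_tauStep (j j' m m₁ m₁' m₂ : ℤ) (hj : j' = j + 1) (h1 : m₁ = m + 1)
    (h1' : m₁' = m + 1) (h2 : m₂ = m₁' + 1) (x : Pi2 (X.sphereValue j' m₁)) :
    pi2Map (loopToHofib (X.tauStep j j' m₁' m₂ hj h2))
      (pi2Map (X.deloopHom (-j) m m₁' h1' (op E.sphereZero))
        (pi2Map (X.tauStep j j' m m₁ hj h1) x)) = 0 := by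
  obtain rfl : m₁ = m₁' := h1.trans h1'.symm
  obtain ⟨g, rfl⟩ := exists_squareClass x
  have hg : Continuous g := g.1.continuous
  have hn : -j = -j' + 1 := by omega
  let S := op E.sphereZero
  let D := X.deloop (-j) m₁ m₂ h2 S
  let v : (Fin 2 → I) → (X.obj (-j) m₁).obj (op (E.suspFP.obj E.sphereZero)) :=
    fun c => (X.desusp (-j') (-j) m₁ hn).app S (g c)
  have hv : Continuous v := (continuous_hom _).comp hg
  let ω : (Fin 2 → I) → I → (X.obj (-j) m₁).obj S := fun c t =>
    (X.enriched (-j) m₁).loopAt E.sphereZero (v c) t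
  have hω : Continuous fun y : (Fin 2 → I) × I => ω y.1 y.2 :=
    (continuous_induced_dom.comp (((X.enriched (-j) m₁).continuous_loopAt E.sphereZero).comp
      (hv.comp continuous_fst))).eval continuous_snd
  -- A double loop: the first coordinate is the suspension coordinate that defines `τ`, the second
  -- the delooping coordinate. For fixed first coordinate it deloops `ω`, which is `τ x` seen as a
  -- loop one level up.
  let Φ : (Fin 2 → I) → I × I → (X.obj (-j) m₂).obj S := fun c y =>
    loopPath (D (ω c y.1)) y.2
  have hΦ : Continuous fun y : (Fin 2 → I) × (I × I) => Φ y.1 y.2 :=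
    continuous_loopPath_eval (D.continuous.comp (hω.comp
      (continuous_fst.prodMk (continuous_fst.comp continuous_snd))))
      (continuous_snd.comp continuous_snd)
  let ζ : (Fin 2 → I) → I → X.sphereValue j' m₂ := fun c s =>
    loopPath (X.deloop (-j') m₁ m₂ h2 S (g c)) s
  have hζ : Continuous fun y : (Fin 2 → I) × I => ζ y.1 y.2 :=
    continuous_loopPath_eval ((Homeomorph.continuous _).comp (hg.comp continuous_fst))
      continuous_snd
  -- For fixed second coordinate the same family is `τ`, one level up, of the point `ζ c s` on the
  -- delooping of `g c`. The two readings thus differ by exchanging the coordinates.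
  have Φζ (c t s) : Φ c (t, s) = (X.enriched (-j) m₂).loopAt E.sphereZero
      ((X.desusp (-j') (-j) m₂ hn).app S (ζ c s)) t := by
    refine (X.deloop_map (-j) m₁ m₂ h2 _ (v c) s).trans ?_
    exact congrArg ((X.obj (-j) m₂).map _)
      (X.desusp_deloop (-j') (-j) m₁ m₂ hn h2 S (g c) s)
  have Φpt (c t s) (h : ω c t = ((X.obj (-j) m₁).obj S).pt) :
      Φ c (t, s) = ((X.obj (-j) m₂).obj S).pt := by
    change loopPath (D (ω c t)) s = _
    rw [h, X.deloop_pt, loopPath_pt]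
  have Φb (c t s) (h : t = 0 ∨ t = 1 ∨ s = 0 ∨ s = 1) :
      Φ c (t, s) = ((X.obj (-j) m₂).obj S).pt := by
    rcases h with rfl | rfl | rfl | rfl
    · exact Φpt c 0 s (Path.source _)
    · exact Φpt c 1 s (Path.target _)
    · exact Path.source _
    · exact Path.target _
  have gb (c) (hc : c ∈ Cube.boundary (Fin 2)) : g c = (X.sphereValue j' m₁).pt := g.2 c hc
  have ωb (c) (hc : c ∈ Cube.boundary (Fin 2)) (t) : ω c t = ((X.obj (-j) m₁).obj S).pt := by
    have : v c = ((X.obj (-j) m₁).obj (op (E.suspFP.obj E.sphereZero))).pt :=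
      (congrArg _ (gb c hc)).trans ((X.desusp (-j') (-j) m₁ hn).app S).map_pt
    change (X.enriched (-j) m₁).path _ (v c) t = _
    rw [this, IsEnriched.path_pt]
    rfl
  have ζb (c) (hc : c ∈ Cube.boundary (Fin 2)) (t) : ζ c t = (X.sphereValue j' m₂).pt := by
    change loopPath (X.deloop (-j') m₁ m₂ h2 S (g c)) t = _
    rw [gb c hc]
    exact congrArg (fun y => loopPath y t) (X.deloop_pt (-j') m₁ m₂ h2 S)
  -- The quarter turn exchanges the coordinates and reverses one, so `ω` is homotopic to the image
  -- under `τ` of `ζ` reversed. The sign is harmless, since the image of any loop in the source of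
  -- `τ` dies in its homotopy fibre.
  obtain ⟨A, A0, A1, As, At, Ab⟩ := exists_rotated_family D (X.deloop_pt _ _ _ _ _) Φ hΦ Φb
    fun c hc y => Φpt c y.1 y.2 (ωb c hc _)
  change squareClass (mapSquare _ (mapSquare _ (mapSquare _ g))) = 0
  refine squareClass_hofib_eq_zero _ _ A ζ hζ (fun c => rfl) (fun c t => ?_) (fun c t => ?_)
    As At Ab (fun c => Path.source _) (fun c => Path.target _) ζb
  · have e : A (0, c) t = ω c t := D.injective (loop_ext (A0 c t))
    refine e.trans ?_
    change _ = loopPath (X.deloop (-j) m m₁ h1' S ((X.deloop (-j) m m₁ h1 S).symm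
      (loopMk ((X.enriched (-j) m₁).loopAt E.sphereZero (v c))))) t
    rw [Homeomorph.apply_symm_apply]
    rfl
  · refine D.injective (loop_ext fun s => (A1 c t s).trans ((Φζ c s (σ t)).trans ?_))
    change _ = loopPath (D (D.symm (loopMk ((X.enriched (-j) m₂).loopAt E.sphereZero
      ((X.desusp (-j') (-j) m₂ hn).app S (ζ c (σ t))))))) s
    rw [Homeomorph.apply_symm_apply]
    rfl

/-! ### Calculus of `τ`, reductions and boundary maps -/

theorem tau_self (a p : ℤ) (h : p ≤ p) : X.tau a p p h = 𝟙 _ := by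
  -- The exponent in `tau` is `(p - p).toNat`, which is not syntactically `0`; a variable exponent
  -- can be substituted.
  have (k : ℕ) (hk : p = p + k) (hk0 : k = 0) : X.tauPow a k p p hk = 𝟙 _ := by
    subst hk0; rfl
  exact this _ _ (by omega)

theorem tau_succ (a q : ℤ) (h : q ≤ q + 1) : X.tau a (q + 1) q h = X.tauG a q := by
  have (k : ℕ) (hk : q + 1 = q + k) (hk1 : k = 1) : X.tauPow a k (q + 1) q hk = X.tauG a q := by
    subst hk1; exact Category.id_comp _
  exact this _ _ (by omega)

theorem mulTau_mulTau (a p q r : ℤ) (h : q ≤ p) (h' : r ≤ q) (x : X.pi a p) :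
    X.mulTau a q r h' (X.mulTau a p q h x) = X.mulTau a p r (h'.trans h) x := by
  rw [mulTau, mulTau, ← pi2Map_comp, tau_comp]; rfl

theorem mulTau_self (a p : ℤ) (h : p ≤ p) (x : X.pi a p) : X.mulTau a p p h x = x := by
  rw [mulTau, tau_self, pi2Map_id]

theorem mulTau_neg (a p q : ℤ) (h : q ≤ p) (x : X.pi a p) :
    X.mulTau a p q h (-x) = -X.mulTau a p q h x := pi2Map_neg _ _

theorem delta_add (a q p : ℤ) (h : q ≤ p) (x y : X.piMod a q p h) :
    X.delta a q p h (x + y) = X.delta a q p h x + X.delta a q p h y := pi2Map_add _ _ _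

theorem delta_sub (a q p : ℤ) (h : q ≤ p) (x y : X.piMod a q p h) :
    X.delta a q p h (x - y) = X.delta a q p h x - X.delta a q p h y := pi2Map_sub _ _ _

theorem red_neg (a q p : ℤ) (h : q ≤ p) (x : X.pi a q) :
    X.red a q p h (-x) = -X.red a q p h x := pi2Map_neg _ _

theorem redMod_add (a q p p' : ℤ) (h : q ≤ p') (h' : p' ≤ p) (x y : X.piMod a q p (h.trans h')) :
    X.redMod a q p p' h h' (x + y) = X.redMod a q p p' h h' x + X.redMod a q p p' h h' y :=
  pi2Map_add _ _ _

theorem red_mulTau (a q : ℤ) (h : q ≤ q + 1) (x : X.pi a (q + 1)) :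
    X.red a q (q + 1) h (X.mulTau a (q + 1) q h x) = 0 := by
  -- The type `hofib p` depends on the map, so `p` is kept variable until `tau_succ` can be
  -- substituted.
  have key (p) (hp : p = X.tauG (a - 1) q) :
      pi2Map (loopToHofib p) (pi2Map (X.deloopG a q) (pi2Map (X.tauG a q) x)) = 0 := by
    subst hp
    exact X.pi2Map_loopToHofib_tauStep q (q + 1) _ _ _ _ rfl _ _ _ x
  have hx : X.mulTau a (q + 1) q h x = pi2Map (X.tauG a q) x := by rw [mulTau, tau_succ]
  rw [hx, red_eq]
  exact key _ (X.tau_succ (a - 1) q h)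

theorem delta_red (a q p : ℤ) (h : q ≤ p) (x : X.pi a q) :
    X.delta a q p h (X.red a q p h x) = 0 := by
  rw [red_eq]
  exact pi2Map_hofibFst_loopToHofib _ _

theorem mulTau_delta (a q p : ℤ) (h : q ≤ p) (x : X.piMod a q p h) :
    X.mulTau (a - 1) p q h (X.delta a q p h x) = 0 := pi2Map_hofibFst _ x

theorem exists_delta_eq (a q p : ℤ) (h : q ≤ p) (x : X.pi (a - 1) p)
    (hx : X.mulTau (a - 1) p q h x = 0) : ∃ w, X.delta a q p h w = x :=
  pi2Map_hofibFst_surjective _ x hx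

/-- Exactness for the homotopy fibre, transported along the homeomorphism of `G a q` with the loop
space of `G (a - 1) q`. -/
theorem exists_red_eq (a q p : ℤ) (h : q ≤ p) (x : X.piMod a q p h)
    (hx : X.delta a q p h x = 0) : ∃ w, X.red a q p h w = x := by
  obtain ⟨w, rfl⟩ := pi2Map_loopToHofib_surjective _ x hx
  let D := X.deloop (-q) (q - a + 2) (q - (a - 1) + 2) (by omega) (op E.sphereZero)
  let i : loop (X.G (a - 1) q) ⟶ X.G a q := mkHom D.symm D.symm.continuous
    ((Homeomorph.symm_apply_eq _).2 (X.deloop_pt _ _ _ _ _).symm)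
  have hi : i ≫ X.deloopG a q = 𝟙 _ := hom_ext fun y => D.apply_symm_apply y
  refine ⟨pi2Map i w, ?_⟩
  rw [red_eq, ← pi2Map_comp i, hi, pi2Map_id]

theorem delta_redMod (a q p p' : ℤ) (h : q ≤ p') (h' : p' ≤ p) (x : X.piMod a q p (h.trans h')) :
    X.delta a q p' h (X.redMod a q p p' h h' x) =
      X.mulTau (a - 1) p p' h' (X.delta a q p (h.trans h') x) := by
  rw [delta, redMod, mulTau, delta, ← pi2Map_comp, ← pi2Map_comp]; rfl

theorem delta_mulTauMod (a q q' p : ℤ) (h : q ≤ q') (h' : q' ≤ p) (x : X.piMod a q' p h') :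
    X.delta a q p (h.trans h') (X.mulTauMod a q q' p h h' x) = X.delta a q' p h' x := by
  rw [delta, mulTauMod, delta, ← pi2Map_comp]; rfl

theorem redMod_red (a q p p' : ℤ) (h : q ≤ p') (h' : p' ≤ p) (x : X.pi a q) :
    X.redMod a q p p' h h' (X.red a q p (h.trans h') x) = X.red a q p' h x := by
  rw [red_eq, red_eq, redMod, ← pi2Map_comp]
  exact congrArg (fun f => pi2Map f _)
    (hom_ext fun y => hofib_ext (X.tau (a - 1) p p' h').map_pt fun t => rfl)

theorem mulTauMod_self (a q p : ℤ) (h : q ≤ q) (h' : q ≤ p) (x : X.piMod a q p h') :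
    X.mulTauMod a q q p h h' x = x := by
  have key : hofibMap (𝟙 _) (X.tau (a - 1) q q h)
      (by rw [X.tau_comp]; exact (Category.id_comp _).symm) = 𝟙 (hofib (X.tau (a - 1) p q h')) :=
    hom_ext fun y => hofib_ext rfl fun t =>
      congrArg (fun f : X.G (a - 1) q ⟶ X.G (a - 1) q => f (y.1.2 t)) (X.tau_self (a - 1) q h)
  rw [mulTauMod, key, pi2Map_id]

/-- Since `δ x` is killed by the remaining power of `τ`, so is `y` by `τ^{p-q}`, and `y = δ w` for
some `w`. The reduction of `w` and `x` have the same boundary, so they differ by the reduction of a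
class of `π X`, which corrects `w` without changing `δ w`. -/
theorem exists_lift (a q p p' : ℤ) (h : q ≤ p') (h' : p' ≤ p) (x : X.piMod a q p' h)
    (y : X.pi (a - 1) p) (hy : X.mulTau (a - 1) p p' h' y = X.delta a q p' h x) :
    ∃ z : X.piMod a q p (h.trans h'), X.redMod a q p p' h h' z = x ∧
      X.delta a q p (h.trans h') z = y := by
  obtain ⟨w, hw⟩ := X.exists_delta_eq a q p (h.trans h') y (by
    rw [← X.mulTau_mulTau (a - 1) p p' q h' h, hy, mulTau_delta])
  obtain ⟨v, hv⟩ := X.exists_red_eq a q p' h (x - X.redMod a q p p' h h' w) (by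
    rw [delta_sub, delta_redMod, hw, hy, sub_self])
  refine ⟨w + X.red a q p (h.trans h') v, ?_, ?_⟩
  · rw [redMod_add, redMod_red, hv, add_sub_cancel]
  · rw [delta_add, delta_red, hw, add_zero]

/-! ### Naturality, and invariance under equivalences -/

namespace Hom

variable {X} {Y : SyntheticSpectrum.{u} E} (f : Hom X Y)

theorem mapMod_red (a q p : ℤ) (h : q ≤ p) (x : X.pi a q) :
    f.mapMod a q p h (X.red a q p h x) = Y.red a q p h (f.mapPi a q x) := by
  rw [red_eq, red_eq, mapMod, mapPi, ← pi2Map_comp, ← pi2Map_comp, ← pi2Map_comp, ← pi2Map_comp]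
  refine congrArg (fun g => pi2Map g x) (hom_ext fun y => hofib_ext (f.mapG (a - 1) p).map_pt
    fun t => ?_)
  exact (f.app_deloop (-q) (q - a + 2) (q - (a - 1) + 2) (by omega) _ y t).symm

theorem delta_mapMod (a q p : ℤ) (h : q ≤ p) (x : X.piMod a q p h) :
    Y.delta a q p h (f.mapMod a q p h x) = f.mapPi (a - 1) p (X.delta a q p h x) := by
  rw [mapMod, delta, delta, mapPi, ← pi2Map_comp, ← pi2Map_comp]; rfl

theorem mulTau_mapPi (a p q : ℤ) (h : q ≤ p) (x : X.pi a p) :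
    Y.mulTau a p q h (f.mapPi a p x) = f.mapPi a q (X.mulTau a p q h x) := by
  rw [mapPi, mapPi, mulTau, mulTau, ← pi2Map_comp, ← pi2Map_comp, mapG_tau]

theorem mapPi_neg (a j : ℤ) (x : X.pi a j) : f.mapPi a j (-x) = -f.mapPi a j x := pi2Map_neg _ _

theorem IsEquiv.mapPi_bijective {f : Hom X Y} (hf : f.IsEquiv) (a j : ℤ) :
    Function.Bijective (f.mapPi a j) :=
  pi2Map_bijective (hf _ _ _)

/-- The surjective half of the five lemma, chased through `red`, `delta` and `mulTau`. Surjectivity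
suffices: it provides a preimage along the left leg of a `Map`, hence a value of `α`. -/
theorem IsEquiv.mapMod_surjective {f : Hom X Y} (hf : f.IsEquiv) (a q p : ℤ) (h : q ≤ p) :
    Function.Surjective (f.mapMod a q p h) := by
  intro y
  obtain ⟨v, hv⟩ := (hf.mapPi_bijective (a - 1) p).2 (Y.delta a q p h y)
  obtain ⟨u, rfl⟩ := X.exists_delta_eq a q p h v ((hf.mapPi_bijective (a - 1) q).1 (by
    rw [← mulTau_mapPi, hv, mulTau_delta, mapPi, pi2Map_zero]))
  obtain ⟨c, hc⟩ := Y.exists_red_eq a q p h (y - f.mapMod a q p h u) (by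
    rw [delta_sub, delta_mapMod, hv, sub_self])
  obtain ⟨c, rfl⟩ := (hf.mapPi_bijective a q).2 c
  refine ⟨u + X.red a q p h c, ?_⟩
  rw [mapMod, pi2Map_add]
  change f.mapMod a q p h u + f.mapMod a q p h _ = y
  rw [mapMod_red, hc, add_sub_cancel]

end Hom

end SyntheticSpectrum

/-! ### Maximal divisibility by `τ` and the Leibniz rule -/

namespace SyntheticSpectrum

variable {E : HomologyTheory.{v}} (X : SyntheticSpectrum.{u} E)

/-- If `δ x` is divisible by a higher power of `τ` than `d_q` requires, the representative can be
chosen as a multiple of `τ`, and it reduces to `0`. -/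
theorem isDifferential_zero (q : ℕ) (hq : 2 ≤ q) {a j j' p : ℤ} (hj : j' = j + q - 1)
    (hp : j' < p) (x : X.modTau a j) (y : X.pi (a - 1) p)
    (hy : X.mulTau (a - 1) p (j + 1) (by omega) y = X.delta a j (j + 1) (by omega) x) :
    X.IsDifferential q hq hj x 0 := by
  refine ⟨X.mulTau (a - 1) p j' hp.le y, by rw [mulTau_mulTau, hy], ?_⟩
  rw [← X.mulTau_mulTau (a - 1) p (j' + 1) j' (by omega) (by omega), red_mulTau, neg_zero]

namespace Map

variable {X} {Y : SyntheticSpectrum.{u} E} (α : Map X Y)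

/-- One preimage `u` along the left leg witnesses both `α x = w` and `α (δ x) = δ w`. -/
theorem exists_mod_of_piMod {a q p : ℤ} {h : q ≤ p} (x : X.piMod a q p h) :
    ∃ w, α.Mod x w ∧ α.Pi (X.delta a q p h x) (Y.delta a q p h w) := by
  obtain ⟨u, rfl⟩ := α.left_isEquiv.mapMod_surjective a q p h x
  exact ⟨_, ⟨u, rfl, rfl⟩, α.apex.delta a q p h u, (α.left.delta_mapMod a q p h u).symm,
    (α.right.delta_mapMod a q p h u).symm⟩

theorem Pi.neg {α : Map X Y} {a j : ℤ} {x : X.pi a j} {y : Y.pi a j} (h : α.Pi x y) :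
    α.Pi (-x) (-y) := by
  obtain ⟨u, rfl, rfl⟩ := h
  exact ⟨-u, α.left.mapPi_neg a j u, α.right.mapPi_neg a j u⟩

end Map

/-- An element of `π (X/τ^{r-1})` is `τ^s` times another one for a largest `s ≤ r - 2`. -/
theorem exists_maximal_mulTauMod (r : ℕ) (hr : 2 ≤ r) {a j : ℤ}
    (w : X.piMod a j (j + r - 1) (by omega)) :
    ∃ (s : ℕ) (hs : s + 1 < r) (y : X.piMod a (j + s) (j + r - 1) (by omega)),
      w = X.mulTauMod a j (j + s) (j + r - 1) (by omega) (by omega) y ∧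
      ∀ h : s + 2 < r, ∀ z : X.piMod a (j + s + 1) (j + r - 1) (by omega),
        w ≠ X.mulTauMod a j (j + s + 1) (j + r - 1) (by omega) (by omega) z := by
  classical
  -- The weight is a variable `q` with `q = j + s`, since `j + 0` and `j + (s + 1 : ℕ)` do not match
  -- `j` and `j + s + 1` definitionally.
  let P : ℕ → Prop := fun s => ∃ (hs : s + 1 < r) (q : ℤ) (hq : q = j + s)
    (y : X.piMod a q (j + r - 1) (by omega)),
      w = X.mulTauMod a j q (j + r - 1) (by omega) (by omega) y
  have h0 : P 0 := ⟨by omega, j, by simp, w, (X.mulTauMod_self a j _ _ _ w).symm⟩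
  have hP := Nat.findGreatest_spec (P := P) (Nat.zero_le r) h0
  have hmax : ∀ k, Nat.findGreatest P r < k → k ≤ r → ¬ P k := fun k =>
    Nat.findGreatest_is_greatest
  generalize Nat.findGreatest P r = s at hP hmax
  obtain ⟨hs, q, rfl, y, hy⟩ := hP
  exact ⟨s, hs, y, hy, fun h z hz => hmax (s + 1) (by omega) (by omega)
    ⟨by omega, j + s + 1, by push_cast; ring, z, hz⟩⟩

/-- An element of `π X` is divisible by all powers of `τ`, or it is `τ^s` times another one for a
largest `s`. -/
theorem divisible_or_exists_maximal_mulTau {a j : ℤ} (w : X.pi a j) :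
    (∀ s : ℕ, ∃ z : X.pi a (j + s), w = X.mulTau a (j + s) j (by omega) z) ∨
      ∃ (s : ℕ) (y : X.pi a (j + s)), w = X.mulTau a (j + s) j (by omega) y ∧
        ∀ z : X.pi a (j + s + 1), w ≠ X.mulTau a (j + s + 1) j (by omega) z := by
  classical
  by_cases h : ∀ s : ℕ, ∃ (q : ℤ) (hq : q = j + s) (z : X.pi a q),
      w = X.mulTau a q j (by omega) z
  · left
    intro s
    obtain ⟨q, rfl, z, hz⟩ := h s
    exact ⟨z, hz⟩
  · right
    push Not at h
    have hspec := Nat.find_spec h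
    have hmin := fun m (hm : m < Nat.find h) => Nat.find_min h hm
    generalize Nat.find h = k at hspec hmin
    -- `k` is the least exponent for which `τ^k` does not divide `w`. It is not `0`, so its
    -- predecessor is the largest exponent that works.
    rcases k with _ | s
    · exact absurd (X.mulTau_self a j le_rfl w).symm (hspec j (by simp) w)
    · have := hmin s (Nat.lt_succ_self s)
      push Not at this
      obtain ⟨q, rfl, y, hy⟩ := this
      exact ⟨s, y, hy, hspec (j + s + 1) (by push_cast; ring)⟩

end SyntheticSpectrum

/-- The generalized Leibniz rule. Let `x` survive to the `E_r` page and let `d` be a representative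
of `d_r x`. Then some maximal hidden `α`-extension `y` of `x` on the `E_r` page supports a
differential whose target is a maximal hidden `α`-extension of `d` on the `E_∞` page: either this
is an extension by `s' < ∞` to some `z`, and `d_{r+s'-s} y = z`, or it is an extension by `∞`
to `0`, and all differentials vanish on `y`. -/
theorem mainTheorem3 {E : HomologyTheory.{v}} {X Y : SyntheticSpectrum.{u} E}
    (α : SyntheticSpectrum.Map X Y) {a j : ℤ} (r : ℕ) (hr : 2 ≤ r) (x : X.modTau a j)
    (hx : X.SurvivesTo r hr x) (d : X.modTau (a - 1) (j + r - 1))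
    (hd : X.IsDifferential r hr rfl x d) :
    ∃ (s : ℕ) (hs : s + 1 < r) (y : Y.modTau a (j + s)), α.IsMaximalExtension r s hs x y ∧
      ((∃ (s' : ℕ) (z : Y.modTau (a - 1) (j + r - 1 + s')), α.IsMaximalExtensionInfty s' d z ∧
          Y.IsDifferential (r + s' - s) (by omega) (by omega) y z) ∨
        (α.HasInfiniteExtension d ∧
          ∀ q (hq : 2 ≤ q), Y.IsDifferential q hq (j' := j + s + q - 1) rfl y 0)) := by
  obtain ⟨y₀, hy₀, rfl⟩ := hd
  obtain ⟨x', hx', rfl⟩ := X.exists_lift a j (j + r - 1) (j + 1) (by omega) (by omega) x y₀ hy₀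
  obtain ⟨w, hw, hδ⟩ := α.exists_mod_of_piMod x'
  obtain ⟨s, hs, y', hy', hmax⟩ := Y.exists_maximal_mulTauMod r hr w
  refine ⟨s, hs, Y.redMod a (j + s) (j + r - 1) (j + s + 1) (by omega) (by omega) y',
    ⟨x', y', hx', rfl, w, hw, hy', hmax⟩, ?_⟩
  -- The double negation lets a factorisation of `-δ w`, the image of the lift `-y₀` of `d`, be
  -- substituted directly.
  have hδy : Y.mulTau (a - 1) (j + r - 1) (j + s + 1) (by omega)
      (-(-Y.delta a j (j + r - 1) (by omega) w)) = Y.delta a (j + s) (j + s + 1) (by omega)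
        (Y.redMod a (j + s) (j + r - 1) (j + s + 1) (by omega) (by omega) y') := by
    rw [neg_neg, Y.delta_redMod, hy', Y.delta_mulTauMod]
  have hα := hδ.neg
  rcases Y.divisible_or_exists_maximal_mulTau (-Y.delta a j (j + r - 1) (by omega) w) with
    hdiv | ⟨s', z, hz, hzmax⟩
  · refine Or.inr ⟨⟨_, X.red_neg _ _ _ _ _, _, hα, hdiv⟩, fun q hq => ?_⟩
    -- The exponent `s + q` puts `z` in weight `j + r - 1 + s + q`, strictly above the weight `j + s
    -- + q - 1` of the target of `d_q`.
    obtain ⟨z, hz⟩ := hdiv (s + q)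
    refine Y.isDifferential_zero q hq rfl (p := j + r - 1 + (s + q : ℕ)) (by push_cast; omega) _
      (-z) ?_
    rw [← hδy, hz, ← Y.mulTau_neg, Y.mulTau_mulTau]
  -- The witness for the differential is `-z`: the sign in the definition of `d_r` turns its
  -- reduction back into that of `z`.
  · refine Or.inl ⟨s', Y.red (a - 1) (j + r - 1 + s') (j + r - 1 + s' + 1) (by omega) z,
      ⟨_, z, X.red_neg _ _ _ _ _, rfl, _, hα, hz, hzmax⟩, -z, ?_, ?_⟩
    · rw [← hδy, hz, ← Y.mulTau_neg, Y.mulTau_mulTau]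
    · rw [Y.red_neg, neg_neg]
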